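/- Let $\Omega\subset\mathbb{R}^3$ be a bounded domain with analytic boundary $\Gamma=\partial\Omega$ that is star-shaped with respect to a ball. Let $(\cdot,\cdot)$ and $\|\cdot\|$ denote the inner product and norm of complex-valued (scalar or vector) functions in $L^2(\Omega)$ (conjugation on the second argument), let $(\cdot,\cdot)_\Gamma$ denote the inner product of $L^2(\Gamma)$ with respect to the surface measure, and let $\gamma_0:H^1(\Omega)\to L^2(\Gamma)$ be the trace operator, i.e. the (existing and unique) bounded linear operator with $\gamma_0(\varphi|_\Omega)=\varphi|_\Gamma$ for all $\varphi\in C^\infty(\mathbb{R}^3)$. For $\zeta\in\mathbb{C}$ and $\rho>0$ define $$a_\zeta(u,v):=(\nabla u,\nabla v)+\zeta^2(u,v)+\zeta(\gamma_0u,\gamma_0v)_\Gamma,\qquad \|u\|_\rho:=\left(\|\nabla u\|^2+\rho^2\|u\|^2\right)^{1/2}\qquad (u,v\in H^1(\Omega)).$$ Then for every $\zeta\in\mathbb{C}$ with $\operatorname{Re}\zeta\ge 0$ the sesquilinear form $a_\zeta$ is continuous on $H^1(\Omega)\times H^1(\Omega)$, and there is a constant $C_b\ge 0$, depending only on $\Omega$,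 such that for every $\zeta\in\mathbb{C}$ with $\operatorname{Re}\zeta\ge 0$ and $|\zeta|\ge 1$ $$|a_\zeta(u,v)|\le(1+C_b)\,\|u\|_{|\zeta|}\,\|v\|_{|\zeta|}\qquad\text{for all }u,v\in H^1(\Omega).$$ -/

import Mathlib

open MeasureTheory
open scoped ContDiff

noncomputable section

namespace RobinHelmholtz

/-- Euclidean three-space. -/
abbrev E3 : Type := EuclideanSpace ℝ (Fin 3)

/-- The boundary of `Ω` is analytic: near each boundary point, `Ω` is the sublevel set
`{ρ < 0}` of a real-analytic function `ρ` whose derivative does not vanish at that point. -/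
def HasAnalyticBoundary (Ω : Set E3) : Prop :=
  ∀ x ∈ frontier Ω, ∃ (U : Set E3) (ρ : E3 → ℝ), IsOpen U ∧ x ∈ U ∧
    AnalyticOnNhd ℝ ρ U ∧ fderiv ℝ ρ x ≠ 0 ∧ Ω ∩ U = {y ∈ U | ρ y < 0}

/-- `Ω` is star-shaped with respect to (every point of) some ball. -/
def StarShapedWrtBall (Ω : Set E3) : Prop :=
  ∃ (x₀ : E3) (r : ℝ), 0 < r ∧ ∀ y ∈ Metric.ball x₀ r, StarConvex ℝ y Ω

/-- The admissible domains: bounded domains (open connected non-empty sets) in `ℝ³` with analytic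
boundary that are star-shaped with respect to a ball. -/
structure IsAdmissibleDomain (Ω : Set E3) : Prop where
  isOpen : IsOpen Ω
  isConnected : IsConnected Ω
  isBounded : Bornology.IsBounded Ω
  analyticBoundary : HasAnalyticBoundary Ω
  starShaped : StarShapedWrtBall Ω

/-- The space `L²(Ω)` of complex-valued functions. -/
abbrev L2 (Ω : Set E3) : Type := Lp ℂ 2 ((volume : Measure E3).restrict Ω)

/-- The space `L²(Ω)³` of complex vector fields. -/
abbrev L2Vec (Ω : Set E3) : Type :=
  Lp (EuclideanSpace ℂ (Fin 3)) 2 ((volume : Measure E3).restrict Ω)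

/-- The surface measure on `Γ = ∂Ω`: the two-dimensional Hausdorff measure, normalised to agree
with Lebesgue measure on planes. -/
def surfaceMeasure (Ω : Set E3) : Measure E3 :=
  (Measure.euclideanHausdorffMeasure 2 : Measure E3).restrict (frontier Ω)

/-- The space `L²(Γ)`, where `Γ = ∂Ω`. -/
abbrev L2Boundary (Ω : Set E3) : Type := Lp ℂ 2 (surfaceMeasure Ω)

/-- `φ` is a test function on `Ω`, i.e. `φ ∈ C_c^∞(Ω)`. -/
def IsTestFunction (Ω : Set E3) (φ : E3 → ℝ) : Prop :=
  ContDiff ℝ ∞ φ ∧ HasCompactSupport φ ∧ tsupport φ ⊆ Ω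

/-- The `i`-th partial derivative of `φ`. -/
def partialDeriv (i : Fin 3) (φ : E3 → ℝ) (x : E3) : ℝ :=
  fderiv ℝ φ x (EuclideanSpace.single i 1)

/-- `G` is the weak (distributional) gradient of `u` on `Ω`. -/
def IsWeakGradient (Ω : Set E3) (u : E3 → ℂ) (G : E3 → EuclideanSpace ℂ (Fin 3)) : Prop :=
  ∀ φ : E3 → ℝ, IsTestFunction Ω φ → ∀ i : Fin 3,
    ∫ x in Ω, partialDeriv i φ x • u x = - ∫ x in Ω, φ x • G x i

theorem IsTestFunction.memLp {Ω : Set E3} {φ : E3 → ℝ} (hφ : IsTestFunction Ω φ) :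
    MemLp φ 2 ((volume : Measure E3).restrict Ω) :=
  (hφ.1.continuous.memLp_of_hasCompactSupport hφ.2.1).restrict Ω

theorem IsTestFunction.memLp_partialDeriv {Ω : Set E3} {φ : E3 → ℝ} (hφ : IsTestFunction Ω φ)
    (i : Fin 3) : MemLp (partialDeriv i φ) 2 ((volume : Measure E3).restrict Ω) := by
  have hc : Continuous (partialDeriv i φ) :=
    (hφ.1.continuous_fderiv (by simp)).clm_apply continuous_const
  have hs : HasCompactSupport (partialDeriv i φ) :=
    hφ.2.1.fderiv_apply (𝕜 := ℝ) _
  exact (hc.memLp_of_hasCompactSupport hs).restrict Ω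

theorem integrable_smul_L2 {Ω : Set E3} {f : E3 → ℝ}
    (hf : MemLp f 2 ((volume : Measure E3).restrict Ω)) (u : L2 Ω) :
    Integrable (fun x => f x • u x) ((volume : Measure E3).restrict Ω) :=
  memLp_one_iff_integrable.mp ((Lp.memLp u).smul hf)

theorem integrable_smul_L2Vec {Ω : Set E3} {f : E3 → ℝ}
    (hf : MemLp f 2 ((volume : Measure E3).restrict Ω)) (G : L2Vec Ω) (i : Fin 3) :
    Integrable (fun x => f x • G x i) ((volume : Measure E3).restrict Ω) := by
  have hG : MemLp (fun x => G x i) 2 ((volume : Measure E3).restrict Ω) :=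
    (EuclideanSpace.proj i : EuclideanSpace ℂ (Fin 3) →L[ℂ] ℂ).comp_memLp' (Lp.memLp G)
  exact memLp_one_iff_integrable.mp (hG.smul hf)

/-- The Sobolev space `H¹(Ω)`: the pairs `(u, ∇u)` with `u ∈ L²(Ω)` whose weak gradient `∇u` lies in
`L²(Ω)³`. As a subspace of the Hilbert space `L²(Ω) × L²(Ω)³` it carries the usual norm
`(‖u‖² + ‖∇u‖²)^{1/2}`. -/
def H1 (Ω : Set E3) : Submodule ℂ (WithLp 2 (L2 Ω × L2Vec Ω)) where
  carrier := {p | IsWeakGradient Ω p.fst p.snd}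
  zero_mem' := by
    intro φ _ i
    have h1 : ∫ x in Ω, partialDeriv i φ x • (0 : L2 Ω) x = 0 := by
      refine integral_eq_zero_of_ae ?_
      filter_upwards [Lp.coeFn_zero ℂ 2 ((volume : Measure E3).restrict Ω)] with x hx
      rw [hx, Pi.zero_apply, smul_zero]
    have h2 : ∫ x in Ω, φ x • (0 : L2Vec Ω) x i = 0 := by
      refine integral_eq_zero_of_ae ?_
      filter_upwards [Lp.coeFn_zero (EuclideanSpace ℂ (Fin 3)) 2
        ((volume : Measure E3).restrict Ω)] with x hx
      rw [hx, Pi.zero_apply, PiLp.zero_apply, smul_zero]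
      rfl
    simp only [WithLp.zero_fst, WithLp.zero_snd]
    rw [h1, h2, neg_zero]
  add_mem' := by
    intro p q hp hq φ hφ i
    have h1 : ∫ x in Ω, partialDeriv i φ x • (p.fst + q.fst) x =
        (∫ x in Ω, partialDeriv i φ x • p.fst x) + ∫ x in Ω, partialDeriv i φ x • q.fst x := by
      rw [← integral_add (integrable_smul_L2 (hφ.memLp_partialDeriv i) _)
        (integrable_smul_L2 (hφ.memLp_partialDeriv i) _)]
      refine integral_congr_ae ?_
      filter_upwards [Lp.coeFn_add p.fst q.fst] with x hx
      rw [hx, Pi.add_apply, smul_add]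
    have h2 : ∫ x in Ω, φ x • (p.snd + q.snd) x i =
        (∫ x in Ω, φ x • p.snd x i) + ∫ x in Ω, φ x • q.snd x i := by
      rw [← integral_add (integrable_smul_L2Vec hφ.memLp _ i)
        (integrable_smul_L2Vec hφ.memLp _ i)]
      refine integral_congr_ae ?_
      filter_upwards [Lp.coeFn_add p.snd q.snd] with x hx
      rw [hx, Pi.add_apply, PiLp.add_apply, smul_add]
    simp only [WithLp.add_fst, WithLp.add_snd]
    rw [h1, h2, hp φ hφ i, hq φ hφ i, neg_add]
  smul_mem' := by
    intro c p hp φ hφ i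
    have h1 : ∫ x in Ω, partialDeriv i φ x • (c • p.fst) x =
        c * ∫ x in Ω, partialDeriv i φ x • p.fst x := by
      rw [← integral_const_mul]
      refine integral_congr_ae ?_
      filter_upwards [Lp.coeFn_smul c p.fst] with x hx
      rw [hx, Pi.smul_apply, smul_eq_mul, mul_smul_comm]
    have h2 : ∫ x in Ω, φ x • (c • p.snd) x i = c * ∫ x in Ω, φ x • p.snd x i := by
      rw [← integral_const_mul]
      refine integral_congr_ae ?_
      filter_upwards [Lp.coeFn_smul c p.snd] with x hx
      rw [hx, Pi.smul_apply, PiLp.smul_apply, smul_eq_mul, mul_smul_comm]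
    simp only [WithLp.smul_fst, WithLp.smul_snd]
    rw [h1, h2, hp φ hφ i, mul_neg]

variable {Ω : Set E3}

/-- The `L²(Ω)` function underlying an element of `H¹(Ω)`. -/
def H1.toL2 (u : H1 Ω) : L2 Ω := (u : WithLp 2 (L2 Ω × L2Vec Ω)).fst

/-- The weak gradient of an element of `H¹(Ω)`. -/
def H1.grad (u : H1 Ω) : L2Vec Ω := (u : WithLp 2 (L2 Ω × L2Vec Ω)).snd

/-- The indexed norm `‖u‖_ρ = (‖∇u‖² + ρ² ‖u‖²)^{1/2}` on `H¹(Ω)`. -/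
def indexedNorm (ρ : ℝ) (u : H1 Ω) : ℝ :=
  Real.sqrt (‖H1.grad u‖ ^ 2 + ρ ^ 2 * ‖H1.toL2 u‖ ^ 2)

/-- `γ` is the trace operator `H¹(Ω) → L²(Γ)`: the bounded linear operator that maps
every `u` which is (the restriction to `Ω` of) a smooth function `φ` on `ℝ³` to `φ|_Γ`. -/
def IsTraceOperator (Ω : Set E3) (γ : H1 Ω →L[ℂ] L2Boundary Ω) : Prop :=
  ∀ (u : H1 Ω) (φ : E3 → ℂ), ContDiff ℝ ∞ φ →
    H1.toL2 u =ᵐ[(volume : Measure E3).restrict Ω] φ → γ u =ᵐ[surfaceMeasure Ω] φ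

open Classical in
/-- The trace operator `γ₀ : H¹(Ω) → L²(Γ)` (the value `0` is a placeholder for sets `Ω` on which
there is no trace operator). -/
def trace (Ω : Set E3) : H1 Ω →L[ℂ] L2Boundary Ω :=
  if h : ∃ γ : H1 Ω →L[ℂ] L2Boundary Ω, IsTraceOperator Ω γ then h.choose else 0

/-- The Robin-Helmholtz sesquilinear form
`a_ζ(u, v) = (∇u, ∇v) + ζ² (u, v) + ζ (γ₀ u, γ₀ v)_Γ` on `H¹(Ω)`, linear in `u` and
conjugate linear in `v`. (Mathlib's `inner ℂ` is conjugate linear in its first argument.) -/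
def robinForm (Ω : Set E3) (ζ : ℂ) : H1 Ω →ₗ[ℂ] H1 Ω →ₗ⋆[ℂ] ℂ :=
  LinearMap.mk₂'ₛₗ (RingHom.id ℂ) (starRingEnd ℂ)
    (fun u v => inner ℂ (H1.grad v) (H1.grad u) + ζ ^ 2 * inner ℂ (H1.toL2 v) (H1.toL2 u)
      + ζ * inner ℂ (trace Ω v) (trace Ω u))
    (by
      intro u u' v
      have h1 : H1.grad (u + u') = H1.grad u + H1.grad u' := rfl
      have h2 : H1.toL2 (u + u') = H1.toL2 u + H1.toL2 u' := rfl
      rw [h1, h2, map_add, inner_add_right, inner_add_right, inner_add_right]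
      ring)
    (by
      intro c u v
      have h1 : H1.grad (c • u) = c • H1.grad u := rfl
      have h2 : H1.toL2 (c • u) = c • H1.toL2 u := rfl
      rw [h1, h2, map_smul, inner_smul_right, inner_smul_right, inner_smul_right,
        RingHom.id_apply, smul_eq_mul]
      ring)
    (by
      intro u v v'
      have h1 : H1.grad (v + v') = H1.grad v + H1.grad v' := rfl
      have h2 : H1.toL2 (v + v') = H1.toL2 v + H1.toL2 v' := rfl
      rw [h1, h2, map_add, inner_add_left, inner_add_left, inner_add_left]
      ring)
    (by
      intro c u v
      have h1 : H1.grad (c • v) = c • H1.grad v := rfl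
      have h2 : H1.toL2 (c • v) = c • H1.toL2 v := rfl
      rw [h1, h2, map_smul, inner_smul_left, inner_smul_left, inner_smul_left, smul_eq_mul]
      ring)

end RobinHelmholtz

end

/-! The volume part of the form is handled by Cauchy–Schwarz in the indexed norms. The boundary term
needs the multiplicative trace inequality `‖γ₀u‖² ≤ C (‖u‖² + ‖u‖ ‖∇u‖)`
(`exists_norm_trace_sq_le`). Multiplied by `|ζ| ≥ 1`, its right side is at most `2C ‖u‖²_{|ζ|}`, so
`C_b = 2C` works.

For smooth `φ` the trace inequality is proved without local charts. With the star centre at the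
origin, the gauge `g` of the domain is Lipschitz, and `y ↦ y / g(y)` projects the punctured domain
radially onto the boundary. The preimage of a boundary ball of radius `ρ` contains a tube of radius
of order `ρ` around a piece of a ray, hence has volume at least of order `ρ²`. A Vitali covering
argument then bounds surface measure by a multiple of the push-forward of volume
(`exists_lintegral_frontier_le_lintegral_radial`). It remains to bound `|φ(y / g(y))|²` on the
domain: the fundamental theorem of calculus along the ray from `y` gives `|φ(y)|²` plus an integral
of `|φ| |∇φ|`, and averaging over `y` costs only the integrable Jacobian `t⁻³`
(`exists_lintegral_frontier_sq_le`).

Smooth functions are dense in `H¹(Ω)` (`denseRange_smoothToH1`): averaging `u((1 - ε)x + εz)` over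
`z` in the ball of star centres is a mollification that never leaves `Ω`, so no extension operator
is needed. Density gives existence and uniqueness of the trace operator and carries the inequality
over to all of `H¹(Ω)`. -/

/-! ### Comparison of Hausdorff measure with a measure having a lower density bound -/

open Metric Set Filter Topology in
/-- If a measure gives balls centred on `K` at least `c` times the `d`-th power of their radius,
then it dominates the `d`-dimensional Hausdorff measure on subsets of `K`. -/
theorem MeasureTheory.Measure.hausdorffMeasure_le_of_le_measure_closedBall {X : Type*}
    [MetricSpace X] [SecondCountableTopology X] [MeasurableSpace X] [BorelSpace X]
    (μ : Measure X) [μ.OuterRegular] {K A : Set X} {d : ℝ} (hd : 0 ≤ d) {c : ENNReal}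
    (hc : c ≠ 0) (hc' : c ≠ ⊤) {R : ℝ} (hR : 0 < R)
    (h : ∀ x ∈ K, ∀ r : ℝ, 0 < r → r ≤ R → c * ENNReal.ofReal r ^ d ≤ μ (closedBall x r))
    (hA : A ⊆ K) :
    Measure.hausdorffMeasure d A ≤ 10 ^ d / c * μ A := by
  -- Disjoint balls kept inside an open `V ⊇ A` have total mass at most `μ V`; outer regularity then
  -- replaces `V` by `A`.
  have key : ∀ V : Set X, IsOpen V → A ⊆ V →
      Measure.hausdorffMeasure d A ≤ 10 ^ d / c * μ V := by
    intro V hV hAV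
    have hcov : ∀ n : ℕ, ∃ (u : Set X) (ρ : X → ℝ), u ⊆ A ∧ u.Countable ∧
        (∀ a ∈ u, 0 < ρ a ∧ ρ a ≤ R / (n + 1) ∧ closedBall a (ρ a) ⊆ V) ∧
        (u.PairwiseDisjoint fun a => closedBall a (ρ a)) ∧
        A ⊆ ⋃ i : u, closedBall (i : X) (5 * ρ i) := by
      intro n
      have hn : 0 < R / ((n : ℝ) + 1) := by positivity
      have h1 : ∀ a : X, ∃ ρ : ℝ, a ∈ A → 0 < ρ ∧ ρ ≤ R / ((n : ℝ) + 1) ∧ closedBall a ρ ⊆ V := by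
        intro a
        by_cases ha : a ∈ A
        · obtain ⟨ε, hε, hεV⟩ := Metric.nhds_basis_closedBall.mem_iff.1 (hV.mem_nhds (hAV ha))
          exact ⟨min ε (R / ((n : ℝ) + 1)), fun _ => ⟨lt_min hε hn, min_le_right _ _,
            (closedBall_subset_closedBall (min_le_left _ _)).trans hεV⟩⟩
        · exact ⟨0, fun h => absurd h ha⟩
      choose ρ hρ using h1
      -- The fivefold enlargements of the disjoint balls cover `A`; their diameters, at most ten
      -- radii, produce the factor `10 ^ d`.
      obtain ⟨u, huA, hud, huc⟩ := Vitali.exists_disjoint_subfamily_covering_enlargement_closedBall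
        A (fun a : X => a) ρ (R / ((n : ℝ) + 1)) (fun a ha => (hρ a ha).2.1) 5 (by norm_num)
      refine ⟨u, ρ, huA, ?_, fun a ha => hρ a (huA ha), hud, ?_⟩
      · refine hud.countable_of_nonempty_interior fun a ha => ?_
        exact ⟨a, ball_subset_interior_closedBall (mem_ball_self (hρ a (huA ha)).1)⟩
      · intro a ha
        obtain ⟨b, hb, hab⟩ := huc a ha
        exact mem_iUnion.2 ⟨⟨b, hb⟩, hab (mem_closedBall_self (hρ a ha).1.le)⟩
    choose u ρ huA hucount hu hud hucov using hcov
    have hcnt : ∀ n, Countable (u n) := fun n => (hucount n).to_subtype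
    have hdiam : ∀ n (i : u n), Metric.ediam (closedBall (i : X) (5 * ρ n i)) ≤
        10 * ENNReal.ofReal (ρ n i) := by
      intro n i
      rw [← Metric.closedEBall_ofReal (by linarith [(hu n i i.2).1])]
      refine Metric.ediam_closedEBall_le.trans (le_of_eq ?_)
      rw [ENNReal.ofReal_mul (by norm_num), ← mul_assoc]
      norm_num
    refine (Measure.hausdorffMeasure_le_liminf_tsum (ι := fun n => u n) (l := atTop) d A
      (fun n : ℕ => 10 * ENNReal.ofReal (R / (n + 1))) ?_
      (fun n i => closedBall (i : X) (5 * ρ n i)) ?_ (Eventually.of_forall hucov)).trans ?_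
    · have h1 : Tendsto (fun n : ℕ => R / ((n : ℝ) + 1)) atTop (𝓝 0) :=
        by
          simpa [Function.comp_def] using
            (tendsto_const_div_atTop_nhds_zero_nat R).comp (tendsto_add_atTop_nat 1)
      have := ENNReal.Tendsto.const_mul (a := 10) (ENNReal.tendsto_ofReal h1)
        (Or.inr (by norm_num))
      simpa using this
    · refine Eventually.of_forall fun n i => (hdiam n i).trans ?_
      gcongr
      exact (hu n i i.2).2.1
    · refine (liminf_le_liminf (v := fun _ => 10 ^ d / c * μ V)
        (Eventually.of_forall fun n => ?_)).trans (le_of_eq (liminf_const _))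
      have h2 : ∀ i : u n, Metric.ediam (closedBall (i : X) (5 * ρ n i)) ^ d ≤
          10 ^ d / c * μ (closedBall (i : X) (ρ n i)) := by
        intro i
        have h3 := h i (hA (huA n i.2)) (ρ n i) (hu n i i.2).1
          ((hu n i i.2).2.1.trans (div_le_self hR.le (by simp)))
        calc Metric.ediam (closedBall (i : X) (5 * ρ n i)) ^ d
            ≤ (10 * ENNReal.ofReal (ρ n i)) ^ d := by gcongr; exact hdiam n i
          _ = 10 ^ d / c * (c * ENNReal.ofReal (ρ n i) ^ d) := by
              rw [ENNReal.mul_rpow_of_nonneg _ _ hd, ← mul_assoc, ENNReal.div_mul_cancel hc hc']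
          _ ≤ _ := by gcongr
      calc ∑' i : u n, Metric.ediam (closedBall (i : X) (5 * ρ n i)) ^ d
          ≤ ∑' i : u n, 10 ^ d / c * μ (closedBall (i : X) (ρ n i)) := ENNReal.tsum_le_tsum h2
        _ = 10 ^ d / c * μ (⋃ i ∈ u n, closedBall i (ρ n i)) := by
            rw [ENNReal.tsum_mul_left, measure_biUnion (hucount n) (hud n)
              (fun i _ => measurableSet_closedBall)]
        _ ≤ _ := by
            gcongr
            exact iUnion₂_subset fun i hi => (hu n i hi).2.2
  have hk0 : (10 : ENNReal) ^ d / c ≠ 0 :=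
    ENNReal.div_ne_zero.2 ⟨(ENNReal.rpow_pos (by norm_num) (by norm_num)).ne', hc'⟩
  have hk1 : (10 : ENNReal) ^ d / c ≠ ⊤ :=
    ENNReal.div_ne_top (ENNReal.rpow_ne_top_of_nonneg hd (by norm_num)) hc
  rw [mul_comm, ← ENNReal.div_le_iff hk0 hk1, Set.measure_eq_iInf_isOpen A μ]
  refine le_iInf fun V => le_iInf fun hAV => le_iInf fun hV => ?_
  rw [ENNReal.div_le_iff hk0 hk1, mul_comm]
  exact key V hV hAV

/-! ### The gauge of a set star-shaped with respect to a ball -/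

section StarShapedGauge

open Metric Set
open scoped Pointwise

variable {E : Type*} [NormedAddCommGroup E] [NormedSpace ℝ E] {D : Set E} {r : ℝ}

theorem ball_subset_of_forall_starConvex (hne : D.Nonempty)
    (hD : ∀ y ∈ ball (0 : E) r, StarConvex ℝ y D) : ball (0 : E) r ⊆ D := fun y hy => by
  obtain ⟨z, hz⟩ := hne
  exact (hD y hy).mem ⟨z, hz⟩

/-- Replaces subadditivity of the gauge, since `D` need not be convex. If `y = b w` with `w ∈ D` and
`z = δ z'` with `z'` in the ball, then `y + z` is `b + δ` times a convex combination of `z'` and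
`w`, which lies in `D` because `z'` is a star centre. Any `δ > ‖z‖ / r` is admissible. -/
theorem gauge_add_le_of_forall_starConvex (hr : 0 < r) (hne : D.Nonempty)
    (hD : ∀ y ∈ ball (0 : E) r, StarConvex ℝ y D) (y z : E) :
    gauge D (y + z) ≤ gauge D y + ‖z‖ / r := by
  have habs : Absorbent ℝ D := absorbent_nhds_zero
    (Filter.mem_of_superset (ball_mem_nhds 0 hr) (ball_subset_of_forall_starConvex hne hD))
  refine le_of_forall_pos_le_add fun ε hε => ?_
  obtain ⟨b, hb, hbg, w, hw, hwy⟩ := exists_lt_of_gauge_lt habs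
    (show gauge D y < gauge D y + ε / 2 by linarith)
  obtain rfl : b • w = y := hwy
  set δ := ‖z‖ / r + ε / 2 with hδ
  have hδ0 : 0 < δ := by positivity
  have hz : δ⁻¹ • z ∈ ball (0 : E) r := by
    rw [mem_ball_zero_iff, norm_smul, norm_inv, Real.norm_of_nonneg hδ0.le, inv_mul_lt_iff₀ hδ0]
    have : δ * r = ‖z‖ + ε / 2 * r := by rw [hδ]; field_simp
    rw [this]
    have : 0 < ε / 2 * r := by positivity
    linarith
  have hmem : b • w + z ∈ (b + δ) • D := by
    refine ⟨(δ / (b + δ)) • (δ⁻¹ • z) + (b / (b + δ)) • w,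
      hD _ hz hw (by positivity) (by positivity) (by field_simp; ring), ?_⟩
    simp only [smul_add, smul_smul]
    rw [add_comm]
    congr 1
    · rw [mul_div_cancel₀ _ (by positivity : b + δ ≠ 0)]
    · rw [show (b + δ) * (δ / (b + δ) * δ⁻¹) = 1 by field_simp, one_smul]
  have := gauge_le_of_mem (by positivity) hmem
  linarith

theorem abs_gauge_sub_le_of_forall_starConvex (hr : 0 < r) (hne : D.Nonempty)
    (hD : ∀ y ∈ ball (0 : E) r, StarConvex ℝ y D) (y z : E) :
    |gauge D y - gauge D z| ≤ ‖y - z‖ / r := by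
  have h1 := gauge_add_le_of_forall_starConvex hr hne hD z (y - z)
  have h2 := gauge_add_le_of_forall_starConvex hr hne hD y (z - y)
  rw [add_sub_cancel] at h1 h2
  rw [norm_sub_rev z y] at h2
  rw [abs_le]
  constructor <;> linarith

theorem continuous_gauge_of_forall_starConvex (hr : 0 < r) (hne : D.Nonempty)
    (hD : ∀ y ∈ ball (0 : E) r, StarConvex ℝ y D) : Continuous (gauge D) := by
  refine (LipschitzWith.of_dist_le_mul (K := (r⁻¹).toNNReal) fun y z => ?_).continuous
  rw [Real.dist_eq, dist_eq_norm, Real.coe_toNNReal _ (by positivity), inv_mul_eq_div]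
  exact abs_gauge_sub_le_of_forall_starConvex hr hne hD y z

theorem gauge_lt_one_iff_of_forall_starConvex (hr : 0 < r) (hne : D.Nonempty)
    (hD : ∀ y ∈ ball (0 : E) r, StarConvex ℝ y D) (hopen : IsOpen D) {y : E} :
    gauge D y < 1 ↔ y ∈ D := by
  refine ⟨fun h => ?_, fun h => gauge_lt_one_of_mem_of_isOpen hopen h⟩
  have habs : Absorbent ℝ D := absorbent_nhds_zero
    (Filter.mem_of_superset (ball_mem_nhds 0 hr) (ball_subset_of_forall_starConvex hne hD))
  obtain ⟨b, hb, hb1, w, hw, rfl⟩ := exists_lt_of_gauge_lt habs h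
  exact (hD 0 (mem_ball_self hr)).smul_mem hw hb.le hb1.le

theorem gauge_eq_one_of_mem_frontier_of_forall_starConvex (hr : 0 < r) (hne : D.Nonempty)
    (hD : ∀ y ∈ ball (0 : E) r, StarConvex ℝ y D) (hopen : IsOpen D) {x : E}
    (hx : x ∈ frontier D) : gauge D x = 1 := by
  rw [hopen.frontier_eq] at hx
  refine le_antisymm ?_ ?_
  · have hsub : closure D ⊆ {y | gauge D y ≤ 1} :=
      closure_minimal (fun y hy => ((gauge_lt_one_iff_of_forall_starConvex hr hne hD hopen).2 hy).le)
        (isClosed_le (continuous_gauge_of_forall_starConvex hr hne hD) continuous_const)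
    exact hsub hx.1
  · exact not_lt.1 fun h => hx.2 ((gauge_lt_one_iff_of_forall_starConvex hr hne hD hopen).1 h)

theorem gauge_le_norm_div_of_forall_starConvex (hr : 0 < r) (hne : D.Nonempty)
    (hD : ∀ y ∈ ball (0 : E) r, StarConvex ℝ y D) (y : E) : gauge D y ≤ ‖y‖ / r := by
  simpa using gauge_add_le_of_forall_starConvex hr hne hD 0 y

theorem gauge_pos_of_forall_starConvex (hr : 0 < r) (hne : D.Nonempty)
    (hD : ∀ y ∈ ball (0 : E) r, StarConvex ℝ y D) (hb : Bornology.IsBounded D) {y : E}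
    (hy : y ≠ 0) : 0 < gauge D y := by
  have habs : Absorbent ℝ D := absorbent_nhds_zero
    (Filter.mem_of_superset (ball_mem_nhds 0 hr) (ball_subset_of_forall_starConvex hne hD))
  exact (gauge_pos habs ((NormedSpace.isVonNBounded_iff ℝ).2 hb)).2 hy

/-- Points near the segment `[x / 2, 3 x / 4]` belong to `D` and project radially close to the
boundary point `x`. -/
theorem radial_projection_near_of_forall_starConvex (hr : 0 < r) (hne : D.Nonempty)
    (hD : ∀ y ∈ ball (0 : E) r, StarConvex ℝ y D) (hopen : IsOpen D) {R : ℝ} {x : E}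
    (hx : gauge D x = 1) (hxR : ‖x‖ ≤ R) {ρ : ℝ} (hρ : 0 < ρ) (hρr : ρ ≤ r) {s : ℝ}
    (hs : 1 / 2 ≤ s) (hs' : s ≤ 3 / 4) {y : E} (hy : ‖y - s • x‖ < ρ / (4 * (1 + R / r))) :
    y ∈ D ∧ ‖(gauge D y)⁻¹ • y - x‖ ≤ ρ := by
  have hR : 0 ≤ R := (norm_nonneg x).trans hxR
  have hgs : gauge D (s • x) = s := by
    rw [gauge_smul_of_nonneg (by linarith), hx, smul_eq_mul, mul_one]
  set z := y - s • x with hz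
  have hLip := abs_gauge_sub_le_of_forall_starConvex hr hne hD y (s • x)
  rw [← hz, hgs] at hLip
  have hq : 0 < 1 + R / r := by positivity
  have hzq : ‖z‖ * (1 + R / r) < ρ / 4 := by
    rw [lt_div_iff₀ (by positivity)] at hy
    linarith
  have hz4 : ‖z‖ / r < 1 / 4 := by
    rw [div_lt_iff₀ hr]
    have : ‖z‖ * 1 ≤ ‖z‖ * (1 + R / r) := by
      gcongr
      have : 0 ≤ R / r := by positivity
      linarith
    linarith
  rw [abs_le] at hLip
  -- The gauge at `y` differs from `s ∈ [1/2, 3/4]` by less than `1/4`. The lower bound `1/4` makes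
  -- the division by the gauge cost a factor 4, which the radius of the tube absorbs.
  have hg1 : gauge D y < 1 := by linarith
  have hg2 : 1 / 4 < gauge D y := by linarith
  refine ⟨(gauge_lt_one_iff_of_forall_starConvex hr hne hD hopen).1 hg1, ?_⟩
  have hg0 : gauge D y ≠ 0 := by linarith
  have heq : (gauge D y)⁻¹ • y - x = (gauge D y)⁻¹ • (z + (s - gauge D y) • x) := by
    rw [hz, sub_smul, sub_add_sub_cancel, smul_sub, smul_smul, inv_mul_cancel₀ hg0, one_smul]
  rw [heq, norm_smul, norm_inv, Real.norm_of_nonneg (by linarith), inv_mul_le_iff₀ (by linarith)]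
  have h1 : ‖z + (s - gauge D y) • x‖ ≤ ‖z‖ * (1 + R / r) := by
    calc ‖z + (s - gauge D y) • x‖ ≤ ‖z‖ + ‖(s - gauge D y) • x‖ := norm_add_le _ _
      _ ≤ ‖z‖ + ‖z‖ / r * R := by
          rw [norm_smul]
          gcongr
          rw [Real.norm_eq_abs, abs_le]
          constructor <;> linarith
      _ = _ := by ring
  calc ‖z + (s - gauge D y) • x‖ ≤ ρ / 4 := h1.trans hzq.le
    _ = 1 / 4 * ρ := by ring
    _ ≤ _ := by gcongr

end StarShapedGauge

/-! ### Volume of radial preimages of boundary balls -/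

namespace RobinHelmholtz

open Metric Set

/-- The part of `D` that projects radially into a ball of radius `ρ` centred at a boundary point
has volume of order at least `ρ ^ 2`. -/
theorem le_volume_radial_preimage_closedBall {D : Set E3} {r R : ℝ} (hr : 0 < r)
    (hne : D.Nonempty) (hD : ∀ y ∈ ball (0 : E3) r, StarConvex ℝ y D) (hopen : IsOpen D) {x : E3}
    (hx : gauge D x = 1) (hxR : ‖x‖ ≤ R) {ρ : ℝ} (hρ : 0 < ρ) (hρr : ρ ≤ r) :
    ENNReal.ofReal (r / 8 * (4 * (1 + R / r))⁻¹ ^ 2) * volume (ball (0 : E3) 1) *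
        ENNReal.ofReal ρ ^ 2 ≤
      volume {y ∈ D | ‖(gauge D y)⁻¹ • y - x‖ ≤ ρ} := by
  have hR : 0 ≤ R := (norm_nonneg x).trans hxR
  set κ := ρ / (4 * (1 + R / r)) with hκ
  have hκ0 : 0 < κ := by positivity
  have hrx : r ≤ ‖x‖ := by
    have := gauge_le_norm_div_of_forall_starConvex hr hne hD x
    rwa [hx, le_div_iff₀ hr, one_mul] at this
  have hx0 : 0 < ‖x‖ := hr.trans_le hrx
  -- The tube around the segment from `x / 2` to `3x / 4`, of length `‖x‖ / 4`, is filled with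
  -- disjoint balls of radius `κ` whose centres are `2κ` apart. Their number is of order `1 / κ` and
  -- each has volume of order `κ³`, whence the exponent 2.
  set N := ⌈‖x‖ / (8 * κ)⌉₊
  set σ : ℕ → ℝ := fun k => 1 / 2 + 2 * k * κ / ‖x‖ with hσ
  have hsub : ⋃ k ∈ Finset.range N, ball (σ k • x) κ ⊆
      {y ∈ D | ‖(gauge D y)⁻¹ • y - x‖ ≤ ρ} := by
    refine iUnion₂_subset fun k hk y hy => ?_
    rw [mem_ball, dist_eq_norm] at hy
    refine radial_projection_near_of_forall_starConvex hr hne hD hopen hx hxR hρ hρr (s := σ k)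
      ?_ ?_ hy
    · have : 0 ≤ 2 * k * κ / ‖x‖ := by positivity
      simp only [hσ]; linarith
    · have h1 : (k : ℝ) < ‖x‖ / (8 * κ) := Nat.lt_ceil.1 (Finset.mem_range.1 hk)
      have h2 : 2 * k * κ / ‖x‖ ≤ 1 / 4 := by
        rw [lt_div_iff₀ (by positivity)] at h1
        rw [div_le_iff₀ hx0]
        linarith
      simp only [hσ]; linarith
  have hdisj : Set.PairwiseDisjoint (↑(Finset.range N)) fun k => ball (σ k • x) κ := by
    intro k _ l _ hkl
    refine ball_disjoint_ball ?_
    rw [dist_eq_norm, ← sub_smul, norm_smul]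
    have h1 : σ k - σ l = 2 * κ * ((k : ℝ) - l) / ‖x‖ := by simp only [hσ]; ring
    rw [h1, norm_div, norm_norm, div_mul_cancel₀ _ hx0.ne', norm_mul,
      Real.norm_of_nonneg (by positivity : 0 ≤ 2 * κ)]
    have h2 : (1 : ℝ) ≤ ‖(k : ℝ) - l‖ := by
      have : (1 : ℤ) ≤ |(k : ℤ) - l| := Int.one_le_abs (sub_ne_zero.2 (by exact_mod_cast hkl))
      rw [Real.norm_eq_abs]
      exact_mod_cast this
    nlinarith
  have hvol : ∀ k, volume (ball (σ k • x) κ) = ENNReal.ofReal (κ ^ 3) * volume (ball (0 : E3) 1) := by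
    intro k
    rw [Measure.addHaar_ball_of_pos _ _ hκ0, finrank_euclideanSpace_fin]
  calc ENNReal.ofReal (r / 8 * (4 * (1 + R / r))⁻¹ ^ 2) * volume (ball (0 : E3) 1) *
        ENNReal.ofReal ρ ^ 2
      = ENNReal.ofReal (r / 8 * (4 * (1 + R / r))⁻¹ ^ 2 * ρ ^ 2) * volume (ball (0 : E3) 1) := by
        rw [ENNReal.ofReal_mul (q := ρ ^ 2) (by positivity), ENNReal.ofReal_pow hρ.le]; ring
    _ ≤ ENNReal.ofReal (N * κ ^ 3) * volume (ball (0 : E3) 1) := by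
        refine mul_le_mul_left (ENNReal.ofReal_le_ofReal ?_) _
        calc r / 8 * (4 * (1 + R / r))⁻¹ ^ 2 * ρ ^ 2 = r / 8 * κ ^ 2 := by
              rw [hκ]; field_simp
          _ ≤ ‖x‖ / (8 * κ) * κ ^ 3 := by
              have : ‖x‖ / (8 * κ) * κ ^ 3 = ‖x‖ / 8 * κ ^ 2 := by field_simp
              rw [this]; gcongr
          _ ≤ _ := by gcongr; exact Nat.le_ceil _
    _ = ∑ k ∈ Finset.range N, volume (ball (σ k • x) κ) := by
        simp only [hvol, Finset.sum_const, Finset.card_range, nsmul_eq_mul]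
        rw [ENNReal.ofReal_mul (by positivity), ENNReal.ofReal_natCast, mul_assoc]
    _ = volume (⋃ k ∈ Finset.range N, ball (σ k • x) κ) :=
        (measure_biUnion_finset hdisj fun _ _ => measurableSet_ball).symm
    _ ≤ _ := measure_mono hsub

end RobinHelmholtz

/-! ### The multiplicative trace inequality for smooth functions -/

namespace RobinHelmholtz

open Metric Set

/-- Integrals over the boundary of a star-shaped set are controlled by integrals over the set of
the radially constant extension of the integrand. -/
theorem exists_lintegral_frontier_le_lintegral_radial {D : Set E3} {r : ℝ} (hr : 0 < r)
    (hne : D.Nonempty) (hD : ∀ y ∈ ball (0 : E3) r, StarConvex ℝ y D) (hopen : IsOpen D)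
    (hb : Bornology.IsBounded D) :
    ∃ C : NNReal, ∀ F : E3 → ENNReal, Measurable F →
      ∫⁻ x, F x ∂(surfaceMeasure D) ≤ C * ∫⁻ y in D, F ((gauge D y)⁻¹ • y) := by
  obtain ⟨R, hR⟩ := hb.subset_closedBall (0 : E3)
  have hR0 : 0 ≤ R := by
    simpa using dist_nonneg.trans (hR (ball_subset_of_forall_starConvex hne hD (mem_ball_self hr)))
  have hπ : Measurable fun y : E3 => (gauge D y)⁻¹ • y :=
    (continuous_gauge_of_forall_starConvex hr hne hD).measurable.inv.smul measurable_id
  have : IsFiniteMeasure ((volume : Measure E3).restrict D) :=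
    ⟨by rw [Measure.restrict_apply_univ]; exact hb.measure_lt_top⟩
  set μ := Measure.map (fun y : E3 => (gauge D y)⁻¹ • y) ((volume : Measure E3).restrict D) with hμ
  -- Finiteness supplies the outer regularity needed for the comparison with Hausdorff measure.
  have : IsFiniteMeasure μ := Measure.isFiniteMeasure_map _ _
  set c := ENNReal.ofReal (r / 8 * (4 * (1 + R / r))⁻¹ ^ 2) * volume (ball (0 : E3) 1) with hc
  have hc0 : c ≠ 0 := by
    refine mul_ne_zero (ENNReal.ofReal_pos.2 (by positivity)).ne'
      (measure_ball_pos _ _ one_pos).ne'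
  have hc1 : c ≠ ⊤ := ENNReal.mul_ne_top ENNReal.ofReal_ne_top measure_ball_lt_top.ne
  have hball : ∀ x ∈ frontier D, ∀ ρ : ℝ, 0 < ρ → ρ ≤ r →
      c * ENNReal.ofReal ρ ^ (2 : ℝ) ≤ μ (closedBall x ρ) := by
    intro x hx ρ hρ hρr
    have hxR : ‖x‖ ≤ R := by
      simpa using closure_minimal hR isClosed_closedBall (frontier_subset_closure hx)
    have h := le_volume_radial_preimage_closedBall hr hne hD hopen
      (gauge_eq_one_of_mem_frontier_of_forall_starConvex hr hne hD hopen hx) hxR hρ hρr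
    rw [ENNReal.rpow_two]
    refine h.trans (le_of_eq ?_)
    rw [hμ, Measure.map_apply hπ measurableSet_closedBall, Measure.restrict_apply' hopen.measurableSet]
    congr 1
    ext y
    simp [dist_eq_norm, and_comm]
  set k : ENNReal := 10 ^ (2 : ℝ) / c with hk
  have hk1 : k ≠ ⊤ :=
    ENNReal.div_ne_top (ENNReal.rpow_ne_top_of_nonneg (by norm_num) (by norm_num)) hc0
  have hle : (Measure.hausdorffMeasure 2 : Measure E3).restrict (frontier D) ≤ k • μ := by
    refine Measure.le_iff.2 fun A hA => ?_
    rw [Measure.restrict_apply hA, Measure.smul_apply, smul_eq_mul]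
    refine (Measure.hausdorffMeasure_le_of_le_measure_closedBall μ (by norm_num) hc0 hc1 hr hball
      inter_subset_right).trans ?_
    gcongr
    exact inter_subset_left
  -- The normalisation factor between `euclideanHausdorffMeasure` and `hausdorffMeasure` in
  -- dimension 2.
  set q : NNReal := Measure.addHaarScalarFactor (volume : Measure (EuclideanSpace ℝ (Fin 2)))
    (Measure.hausdorffMeasure (2 : ℕ)) with hq
  refine ⟨q * k.toNNReal, fun F hF => ?_⟩
  have hs : surfaceMeasure D =
      (q : ENNReal) • (Measure.hausdorffMeasure 2 : Measure E3).restrict (frontier D) := by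
    rw [surfaceMeasure, Measure.euclideanHausdorffMeasure_def, Measure.restrict_smul]
    rw [← hq, ENNReal.smul_def, Nat.cast_ofNat]
  rw [hs, lintegral_smul_measure, smul_eq_mul, ENNReal.coe_mul, ENNReal.coe_toNNReal hk1, mul_assoc]
  gcongr
  refine (lintegral_mono' hle le_rfl).trans ?_
  rw [lintegral_smul_measure, smul_eq_mul, hμ, lintegral_map hF hπ]

/-- The value of `‖φ‖²` at the end of a ray segment is bounded by the value at its start and the
integral of the radial derivative. -/
theorem enorm_sq_smul_le {φ : E3 → ℂ} (hφ : ContDiff ℝ 1 φ) (y : E3) {T : ℝ} (hT : 1 ≤ T) :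
    ‖φ (T • y)‖ₑ ^ 2 ≤ ‖φ y‖ₑ ^ 2 +
      2 * ‖y‖ₑ * ∫⁻ t in Ioo 1 T, ‖φ (t • y)‖ₑ * ‖fderiv ℝ φ (t • y)‖ₑ := by
  have hd : ∀ t : ℝ, HasDerivAt (fun t : ℝ => ‖φ (t • y)‖ ^ 2)
      (2 * inner ℝ (φ (t • y)) (fderiv ℝ φ (t • y) y)) t := by
    intro t
    have h1 : HasDerivAt (fun t : ℝ => t • y) y t := by
      simpa using (hasDerivAt_id t).smul_const y
    have h2 : HasDerivAt (fun t : ℝ => φ (t • y)) (fderiv ℝ φ (t • y) y) t :=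
      ((hφ.differentiable one_ne_zero).differentiableAt.hasFDerivAt (x := t • y)).comp_hasDerivAt t h1
    exact h2.norm_sq
  have hcont : Continuous fun t : ℝ => 2 * inner ℝ (φ (t • y)) (fderiv ℝ φ (t • y) y) := by
    have h1 : Continuous fun t : ℝ => t • y := continuous_id.smul continuous_const
    have h2 : Continuous fun t : ℝ => fderiv ℝ φ (t • y) y :=
      ((hφ.continuous_fderiv one_ne_zero).comp h1).clm_apply continuous_const
    exact continuous_const.mul ((hφ.continuous.comp h1).inner h2)
  have hftc := intervalIntegral.integral_eq_sub_of_hasDerivAt (a := 1) (b := T)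
    (fun t _ => hd t) (hcont.intervalIntegrable _ _)
  rw [intervalIntegral.integral_of_le hT, one_smul] at hftc
  have hbd : ‖‖φ (T • y)‖ ^ 2 - ‖φ y‖ ^ 2‖ₑ ≤
      2 * ‖y‖ₑ * ∫⁻ t in Ioo 1 T, ‖φ (t • y)‖ₑ * ‖fderiv ℝ φ (t • y)‖ₑ := by
    rw [← hftc, integral_Ioc_eq_integral_Ioo, ← lintegral_const_mul' _ _ (by finiteness)]
    refine (enorm_integral_le_lintegral_enorm _).trans (lintegral_mono fun t => ?_)
    rw [enorm_mul, mul_assoc]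
    have h2 : ‖(2 : ℝ)‖ₑ = 2 := by
      rw [← ofReal_norm]; norm_num
    rw [h2]
    gcongr
    rw [← ofReal_norm, ← ofReal_norm, ← ofReal_norm,
      ← ofReal_norm, ← ENNReal.ofReal_mul (norm_nonneg _),
      ← ENNReal.ofReal_mul (norm_nonneg _)]
    refine ENNReal.ofReal_le_ofReal ((norm_inner_le_norm _ _).trans ?_)
    calc ‖φ (t • y)‖ * ‖fderiv ℝ φ (t • y) y‖
        ≤ ‖φ (t • y)‖ * (‖fderiv ℝ φ (t • y)‖ * ‖y‖) := by
          gcongr; exact ContinuousLinearMap.le_opNorm _ _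
      _ = _ := by ring
  have hsq : ∀ z : ℂ, ‖z‖ₑ ^ 2 = ‖‖z‖ ^ 2‖ₑ := fun z => by rw [enorm_pow, enorm_norm]
  rw [hsq, hsq]
  calc ‖‖φ (T • y)‖ ^ 2‖ₑ = ‖‖φ y‖ ^ 2 + (‖φ (T • y)‖ ^ 2 - ‖φ y‖ ^ 2)‖ₑ := by
        rw [add_sub_cancel]
    _ ≤ _ := (enorm_add_le _ _).trans (by gcongr)

/-- Averaging a nonnegative function over dilations with factor at least `1`. -/
theorem lintegral_lintegral_smul_le {H : E3 → ENNReal} (hH : Measurable H) (D : Set E3) :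
    ∫⁻ y in D, ∫⁻ t in Ioi (1 : ℝ), H (t • y) ≤
      (∫⁻ t in Ioi (1 : ℝ), ENNReal.ofReal (t ^ (-3 : ℝ))) * ∫⁻ y, H y := by
  have hm : Measurable fun p : E3 × ℝ => H (p.2 • p.1) :=
    hH.comp (measurable_snd.smul measurable_fst)
  refine (setLIntegral_le_lintegral _ _).trans ?_
  rw [lintegral_lintegral_swap hm.aemeasurable, ← lintegral_mul_const _ (by fun_prop)]
  refine setLIntegral_mono' measurableSet_Ioi fun t ht => ?_
  have ht0 : (0 : ℝ) < t := one_pos.trans ht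
  rw [← lintegral_map (g := fun y : E3 => t • y) hH (measurable_const_smul t),
    Measure.map_addHaar_smul _ ht0.ne', lintegral_smul_measure, finrank_euclideanSpace_fin,
    smul_eq_mul]
  gcongr
  rw [abs_of_pos (by positivity), Real.rpow_neg ht0.le]
  norm_cast

/-- The multiplicative trace inequality for smooth functions on a domain that is star-shaped with
respect to a ball centred at the origin. -/
theorem exists_lintegral_frontier_sq_le_of_zero {D : Set E3} {r : ℝ} (hr : 0 < r)
    (hne : D.Nonempty) (hD : ∀ y ∈ ball (0 : E3) r, StarConvex ℝ y D) (hopen : IsOpen D)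
    (hb : Bornology.IsBounded D) :
    ∃ C : NNReal, ∀ φ : E3 → ℂ, ContDiff ℝ 1 φ →
      ∫⁻ x, ‖φ x‖ₑ ^ 2 ∂(surfaceMeasure D) ≤
        C * ((∫⁻ y in D, ‖φ y‖ₑ ^ 2) + ∫⁻ y in D, ‖φ y‖ₑ * ‖fderiv ℝ φ y‖ₑ) := by
  obtain ⟨C, hC⟩ := exists_lintegral_frontier_le_lintegral_radial hr hne hD hopen hb
  obtain ⟨R, hR⟩ := hb.subset_closedBall (0 : E3)
  have hK : ∫⁻ t in Ioi (1 : ℝ), ENNReal.ofReal (t ^ (-3 : ℝ)) ≠ ⊤ :=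
    (integrableOn_Ioi_rpow_of_lt (by norm_num) one_pos).lintegral_lt_top.ne
  set K := ∫⁻ t in Ioi (1 : ℝ), ENNReal.ofReal (t ^ (-3 : ℝ))
  refine ⟨C * (1 + (2 * ENNReal.ofReal R * K).toNNReal), fun φ hφ => ?_⟩
  have hφm : Measurable fun y => ‖φ y‖ₑ ^ 2 := (hφ.continuous.measurable.enorm).pow_const 2
  have hHm : Measurable fun y => ‖φ y‖ₑ * ‖fderiv ℝ φ y‖ₑ :=
    hφ.continuous.measurable.enorm.mul (hφ.continuous_fderiv one_ne_zero).measurable.enorm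
  -- Cutting off to `D` allows the ray integral to run over all `t > 1`: for `t < 1 / g(y)` the
  -- point `t • y` is still in `D`.
  set H := D.indicator fun y => ‖φ y‖ₑ * ‖fderiv ℝ φ y‖ₑ with hH
  have hHm' : Measurable H := hHm.indicator hopen.measurableSet
  refine (hC _ hφm).trans ?_
  rw [ENNReal.coe_mul, mul_assoc]
  gcongr
  have hpt : ∀ y ∈ D, ‖φ ((gauge D y)⁻¹ • y)‖ₑ ^ 2 ≤ ‖φ y‖ₑ ^ 2 +
      2 * ENNReal.ofReal R * ∫⁻ t in Ioi (1 : ℝ), H (t • y) := by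
    intro y hy
    -- At the origin the projected point is again the origin, so the bound is trivial.
    by_cases hy0 : y = 0
    · simp [hy0]
    have hg0 := gauge_pos_of_forall_starConvex hr hne hD hb hy0
    have hg1 := (gauge_lt_one_iff_of_forall_starConvex hr hne hD hopen).2 hy
    refine (enorm_sq_smul_le hφ y ((one_le_inv₀ hg0).2 hg1.le)).trans ?_
    have hyR : ‖y‖ₑ ≤ ENNReal.ofReal R := by
      rw [← ofReal_norm]
      exact ENNReal.ofReal_le_ofReal (by simpa using hR hy)
    refine add_le_add_right (mul_le_mul' (mul_le_mul_right hyR _) ?_) _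
    · refine (setLIntegral_mono' measurableSet_Ioo fun t ht => le_of_eq ?_).trans
        (lintegral_mono_set (s := Ioo 1 (gauge D y)⁻¹) (t := Ioi 1) Ioo_subset_Ioi_self)
      have : t • y ∈ D := by
        rw [← gauge_lt_one_iff_of_forall_starConvex hr hne hD hopen,
          gauge_smul_of_nonneg (by linarith [ht.1]), smul_eq_mul]
        have := ht.2
        rwa [lt_inv_comm₀ (by linarith [ht.1]) hg0, ← one_div, lt_div_iff₀ (by linarith [ht.1]),
          mul_comm] at this
      rw [hH, indicator_of_mem this]
  calc ∫⁻ y in D, ‖φ ((gauge D y)⁻¹ • y)‖ₑ ^ 2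
      ≤ ∫⁻ y in D, (‖φ y‖ₑ ^ 2 + 2 * ENNReal.ofReal R * ∫⁻ t in Ioi (1 : ℝ), H (t • y)) :=
        setLIntegral_mono' hopen.measurableSet hpt
    _ = (∫⁻ y in D, ‖φ y‖ₑ ^ 2) +
          2 * ENNReal.ofReal R * ∫⁻ y in D, ∫⁻ t in Ioi (1 : ℝ), H (t • y) := by
        rw [lintegral_add_left hφm, lintegral_const_mul' _ _ (by finiteness)]
    _ ≤ (∫⁻ y in D, ‖φ y‖ₑ ^ 2) + 2 * ENNReal.ofReal R * (K * ∫⁻ y, H y) := by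
        gcongr
        exact lintegral_lintegral_smul_le hHm' D
    _ = (∫⁻ y in D, ‖φ y‖ₑ ^ 2) + (2 * ENNReal.ofReal R * K).toNNReal *
          ∫⁻ y in D, ‖φ y‖ₑ * ‖fderiv ℝ φ y‖ₑ := by
        rw [hH, lintegral_indicator hopen.measurableSet, ENNReal.coe_toNNReal (by finiteness),
          mul_assoc (2 * ENNReal.ofReal R)]
    _ ≤ _ := by
        rw [mul_add, ENNReal.coe_add, ENNReal.coe_one]
        gcongr
        · rw [add_mul, one_mul]; exact le_self_add
        · exact le_add_self

/-- The multiplicative trace inequality for smooth functions on a bounded domain that is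
star-shaped with respect to a ball. -/
theorem exists_lintegral_frontier_sq_le {Ω : Set E3} (hΩ : IsOpen Ω) (hne : Ω.Nonempty)
    (hb : Bornology.IsBounded Ω) (hs : StarShapedWrtBall Ω) :
    ∃ C : NNReal, ∀ φ : E3 → ℂ, ContDiff ℝ 1 φ →
      ∫⁻ x, ‖φ x‖ₑ ^ 2 ∂(surfaceMeasure Ω) ≤
        C * ((∫⁻ y in Ω, ‖φ y‖ₑ ^ 2) + ∫⁻ y in Ω, ‖φ y‖ₑ * ‖fderiv ℝ φ y‖ₑ) := by
  obtain ⟨x₀, r, hr, hstar⟩ := hs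
  -- Translation moves the star centre to the origin; volume and Hausdorff measure are preserved.
  set e : E3 ≃ᵢ E3 := IsometryEquiv.addLeft x₀ with he
  have he' : ∀ y, e y = x₀ + y := fun y => rfl
  have hball : ∀ y ∈ ball (0 : E3) r, StarConvex ℝ y (e ⁻¹' Ω) := by
    intro y hy z hz a b ha hb hab
    have h := hstar (x₀ + y) (by simpa using hy) hz ha hb hab
    rw [mem_preimage, he']
    rw [he'] at h
    convert h using 1
    rw [smul_add, smul_add, add_add_add_comm, ← add_smul, hab, one_smul]
  obtain ⟨C, hC⟩ := exists_lintegral_frontier_sq_le_of_zero (D := e ⁻¹' Ω) hr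
    (hne.preimage e.surjective) hball (hΩ.preimage e.continuous)
    (by rw [← e.image_symm]; exact e.symm.isometry.lipschitz.isBounded_image hb)
  refine ⟨C, fun φ hφ => ?_⟩
  have h := hC (fun y => φ (x₀ + y)) (hφ.comp (contDiff_const.add contDiff_id))
  have hemb : MeasurableEmbedding e := e.toHomeomorph.measurableEmbedding
  have hvol : MeasurePreserving e (volume : Measure E3) volume :=
    measurePreserving_add_left volume x₀
  have h1 : ∫⁻ y, ‖φ (x₀ + y)‖ₑ ^ 2 ∂(surfaceMeasure (e ⁻¹' Ω)) =
      ∫⁻ x, ‖φ x‖ₑ ^ 2 ∂(surfaceMeasure Ω) := by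
    rw [surfaceMeasure, surfaceMeasure]
    have h2 : frontier (e ⁻¹' Ω) = e ⁻¹' frontier Ω := (e.toHomeomorph.preimage_frontier Ω).symm
    rw [h2]
    exact (e.measurePreserving_euclideanHausdorffMeasure 2).setLIntegral_comp_preimage_emb hemb
      (fun x => ‖φ x‖ₑ ^ 2) _
  have h2 : ∫⁻ y in e ⁻¹' Ω, ‖φ (x₀ + y)‖ₑ ^ 2 = ∫⁻ y in Ω, ‖φ y‖ₑ ^ 2 :=
    hvol.setLIntegral_comp_preimage_emb hemb (fun x => ‖φ x‖ₑ ^ 2) _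
  have h3 : ∫⁻ y in e ⁻¹' Ω, ‖φ (x₀ + y)‖ₑ * ‖fderiv ℝ (fun y => φ (x₀ + y)) y‖ₑ =
      ∫⁻ y in Ω, ‖φ y‖ₑ * ‖fderiv ℝ φ y‖ₑ := by
    simp only [fderiv_comp_add_left]
    exact hvol.setLIntegral_comp_preimage_emb hemb (fun x => ‖φ x‖ₑ * ‖fderiv ℝ φ x‖ₑ) _
  rwa [h1, h2, h3] at h

end RobinHelmholtz

/-! ### Smooth functions as elements of `H¹(Ω)` and their boundary values -/

noncomputable section

namespace RobinHelmholtz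

open Metric Set

variable {Ω : Set E3}

/-- The smooth complex-valued functions on `ℝ³`. -/
def smoothFunctions : Submodule ℂ (E3 → ℂ) where
  carrier := {φ | ContDiff ℝ ∞ φ}
  zero_mem' := show ContDiff ℝ ∞ (0 : E3 → ℂ) from contDiff_const
  add_mem' {φ ψ} (h : ContDiff ℝ ∞ φ) (h' : ContDiff ℝ ∞ ψ) :=
    show ContDiff ℝ ∞ (φ + ψ) from h.add h'
  smul_mem' c φ (h : ContDiff ℝ ∞ φ) := show ContDiff ℝ ∞ (c • φ) from contDiff_const.smul h

theorem contDiff_smoothFunctions (φ : smoothFunctions) {n : ℕ∞} :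
    ContDiff ℝ n (φ : E3 → ℂ) :=
  ContDiff.of_le (n := ∞) φ.2 (by exact_mod_cast le_top)

/-- The classical gradient of a complex-valued function. -/
def classicalGradient (φ : E3 → ℂ) (x : E3) : EuclideanSpace ℂ (Fin 3) :=
  WithLp.toLp 2 fun i => fderiv ℝ φ x (EuclideanSpace.single i 1)

/-- Cauchy–Schwarz in the coordinates. Equality can fail: for complex values the right side is the
Hilbert–Schmidt norm of the real-linear derivative. -/
theorem norm_fderiv_le_norm_classicalGradient (φ : E3 → ℂ) (x : E3) :
    ‖fderiv ℝ φ x‖ ≤ ‖classicalGradient φ x‖ := by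
  refine ContinuousLinearMap.opNorm_le_bound _ (norm_nonneg _) fun v => ?_
  have hv : v = ∑ i, v i • EuclideanSpace.single i (1 : ℝ) := by
    conv_lhs => rw [← (EuclideanSpace.basisFun (Fin 3) ℝ).sum_repr v]
    simp
  have h1 : fderiv ℝ φ x v = ∑ i, v i • fderiv ℝ φ x (EuclideanSpace.single i 1) := by
    conv_lhs => rw [hv]
    simp only [map_sum, map_smul]
  rw [h1]
  calc ‖∑ i, v i • fderiv ℝ φ x (EuclideanSpace.single i 1)‖
      ≤ ∑ i, ‖fderiv ℝ φ x (EuclideanSpace.single i 1)‖ * ‖v i‖ := by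
        refine (norm_sum_le _ _).trans (le_of_eq (Finset.sum_congr rfl fun i _ => ?_))
        rw [norm_smul, mul_comm]
    _ ≤ _ := by
        rw [EuclideanSpace.norm_eq, EuclideanSpace.norm_eq]
        exact Real.sum_mul_le_sqrt_mul_sqrt _ _ _

theorem continuous_classicalGradient {φ : E3 → ℂ} (hφ : ContDiff ℝ 1 φ) :
    Continuous (classicalGradient φ) := by
  refine (PiLp.continuous_toLp 2 _).comp (continuous_pi fun i => ?_)
  exact (hφ.continuous_fderiv one_ne_zero).clm_apply continuous_const

theorem isFiniteMeasure_restrict_of_isBounded (hb : Bornology.IsBounded Ω) :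
    IsFiniteMeasure ((volume : Measure E3).restrict Ω) :=
  ⟨by rw [Measure.restrict_apply_univ]; exact hb.measure_lt_top⟩

theorem memLp_restrict_of_continuous {F : Type*} [NormedAddCommGroup F]
    [SecondCountableTopology F] {f : E3 → F}
    (hf : Continuous f) {S : Set E3} (hS : MeasurableSet S) (hb : Bornology.IsBounded S)
    {μ : Measure E3} (hμ : IsFiniteMeasure (μ.restrict S)) (p : ENNReal) :
    MemLp f p (μ.restrict S) := by
  obtain ⟨C, hC⟩ := (hb.isCompact_closure.image hf).isBounded.exists_norm_le
  refine MemLp.of_bound (hf.stronglyMeasurable.aestronglyMeasurable) C ?_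
  filter_upwards [ae_restrict_mem hS] with x hx
  exact hC _ (mem_image_of_mem f (subset_closure hx))

theorem IsTestFunction.partialDeriv_eq_zero {φ : E3 → ℝ} (hφ : IsTestFunction Ω φ) (i : Fin 3)
    {x : E3} (hx : x ∉ Ω) : partialDeriv i φ x = 0 := by
  have : x ∉ tsupport (fderiv ℝ φ) := fun h => hx (hφ.2.2 (tsupport_fderiv_subset ℝ h))
  rw [partialDeriv, image_eq_zero_of_notMem_tsupport this]
  rfl

theorem IsTestFunction.eq_zero {φ : E3 → ℝ} (hφ : IsTestFunction Ω φ)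
    {x : E3} (hx : x ∉ Ω) : φ x = 0 :=
  image_eq_zero_of_notMem_tsupport fun h => hx (hφ.2.2 h)

/-- The test function is supported in `Ω`, so both integrals extend to the whole space, where
integration by parts has no boundary term. -/
theorem isWeakGradient_classicalGradient {φ : E3 → ℂ} (hφ : ContDiff ℝ 1 φ) :
    IsWeakGradient Ω φ (classicalGradient φ) := by
  intro ψ hψ i
  rw [setIntegral_eq_integral_of_forall_compl_eq_zero
      (fun x hx => by rw [hψ.partialDeriv_eq_zero i hx, zero_smul]),
    setIntegral_eq_integral_of_forall_compl_eq_zero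
      (fun x hx => by rw [hψ.eq_zero hx, zero_smul])]
  have hdψ : Continuous fun x => fderiv ℝ ψ x (EuclideanSpace.single i 1) :=
    (hψ.1.continuous_fderiv (by simp)).clm_apply continuous_const
  have hdφ : Continuous fun x => fderiv ℝ φ x (EuclideanSpace.single i 1) :=
    (hφ.continuous_fderiv one_ne_zero).clm_apply continuous_const
  have hψc := hψ.1.continuous
  have h1 : Integrable fun x => fderiv ℝ ψ x (EuclideanSpace.single i 1) • φ x :=
    (hdψ.smul hφ.continuous).integrable_of_hasCompactSupport
      ((hψ.2.1.fderiv_apply (𝕜 := ℝ) _).smul_right)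
  have h2 : Integrable fun x => ψ x • fderiv ℝ φ x (EuclideanSpace.single i 1) :=
    (hψc.smul hdφ).integrable_of_hasCompactSupport hψ.2.1.smul_right
  have h3 : Integrable fun x => ψ x • φ x :=
    (hψc.smul hφ.continuous).integrable_of_hasCompactSupport hψ.2.1.smul_right
  have := integral_smul_fderiv_eq_neg_fderiv_smul_of_integrable (μ := volume) h1 h2 h3
    (fun x _ => (hψ.1.differentiable (by simp)) x)
    (fun x _ => (hφ.differentiable one_ne_zero) x)
  simp only [partialDeriv, classicalGradient]
  rw [this, neg_neg]

theorem IsWeakGradient.congr_ae {u u' : E3 → ℂ} {G G' : E3 → EuclideanSpace ℂ (Fin 3)}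
    (h : IsWeakGradient Ω u G) (hu : u =ᵐ[(volume : Measure E3).restrict Ω] u')
    (hG : G =ᵐ[(volume : Measure E3).restrict Ω] G') : IsWeakGradient Ω u' G' := by
  intro φ hφ i
  have h1 : ∫ x in Ω, partialDeriv i φ x • u' x = ∫ x in Ω, partialDeriv i φ x • u x :=
    integral_congr_ae (by filter_upwards [hu] with x hx; rw [hx])
  have h2 : ∫ x in Ω, φ x • G' x i = ∫ x in Ω, φ x • G x i :=
    integral_congr_ae (by filter_upwards [hG] with x hx; rw [hx])
  rw [h1, h2, h φ hφ i]

/-- An element of `H¹(Ω)` is determined by its underlying function: weak gradients are unique. -/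
theorem H1.ext_toL2 (hΩ : IsOpen Ω) (hb : Bornology.IsBounded Ω) {u v : H1 Ω}
    (h : H1.toL2 u = H1.toL2 v) : u = v := by
  have := isFiniteMeasure_restrict_of_isBounded hb
  have hcomp : ∀ i : Fin 3, ∀ᵐ x ∂((volume : Measure E3).restrict Ω),
      H1.grad u x i - H1.grad v x i = 0 := by
    intro i
    have hint : ∀ w : H1 Ω, IntegrableOn (fun x => H1.grad w x i) Ω := fun w =>
      (((EuclideanSpace.proj i : EuclideanSpace ℂ (Fin 3) →L[ℂ] ℂ).comp_memLp'
        (Lp.memLp (H1.grad w))).integrable one_le_two)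
    rw [ae_restrict_iff' hΩ.measurableSet]
    refine hΩ.ae_eq_zero_of_integral_contDiff_smul_eq_zero (μ := volume)
      ((hint u).sub (hint v)).locallyIntegrableOn fun g hg hgc hgs => ?_
    have hgt : IsTestFunction Ω g := ⟨hg, hgc, hgs⟩
    rw [← setIntegral_eq_integral_of_forall_compl_eq_zero (s := Ω)
      (fun x hx => by rw [hgt.eq_zero hx, zero_smul])]
    simp only [smul_sub]
    rw [integral_sub (integrable_smul_L2Vec hgt.memLp _ i) (integrable_smul_L2Vec hgt.memLp _ i)]
    have hu := u.2 g hgt i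
    have hv := v.2 g hgt i
    have h' : (u : WithLp 2 (L2 Ω × L2Vec Ω)).fst = (v : WithLp 2 (L2 Ω × L2Vec Ω)).fst := h
    rw [h'] at hu
    exact sub_eq_zero.2 (neg_injective (hu.symm.trans hv))
  have hgrad : H1.grad u = H1.grad v := by
    refine Lp.ext ?_
    filter_upwards [hcomp 0, hcomp 1, hcomp 2] with x h0 h1 h2
    ext i
    fin_cases i
    · exact sub_eq_zero.1 h0
    · exact sub_eq_zero.1 h1
    · exact sub_eq_zero.1 h2
  refine Subtype.ext ?_
  exact (WithLp.ofLp_injective 2) (Prod.ext h hgrad)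

theorem memLp_smoothFunctions (hΩ : IsOpen Ω) (hb : Bornology.IsBounded Ω)
    (φ : smoothFunctions) : MemLp (φ : E3 → ℂ) 2 ((volume : Measure E3).restrict Ω) :=
  memLp_restrict_of_continuous (contDiff_smoothFunctions φ (n := 0)).continuous hΩ.measurableSet hb
    (isFiniteMeasure_restrict_of_isBounded hb) 2

theorem memLp_classicalGradient (hΩ : IsOpen Ω) (hb : Bornology.IsBounded Ω)
    (φ : smoothFunctions) :
    MemLp (classicalGradient φ) 2 ((volume : Measure E3).restrict Ω) :=
  memLp_restrict_of_continuous (continuous_classicalGradient (contDiff_smoothFunctions φ (n := 1)))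
    hΩ.measurableSet hb (isFiniteMeasure_restrict_of_isBounded hb) 2

/-- The restriction to a bounded open set of smooth functions, as elements of `H¹(Ω)`. -/
def smoothToH1 (hΩ : IsOpen Ω) (hb : Bornology.IsBounded Ω) : smoothFunctions →ₗ[ℂ] H1 Ω where
  toFun φ := ⟨WithLp.toLp 2 ((memLp_smoothFunctions hΩ hb φ).toLp,
    (memLp_classicalGradient hΩ hb φ).toLp),
    (isWeakGradient_classicalGradient (contDiff_smoothFunctions φ (n := 1))).congr_ae
      (MemLp.coeFn_toLp (memLp_smoothFunctions hΩ hb φ)).symm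
      (MemLp.coeFn_toLp (memLp_classicalGradient hΩ hb φ)).symm⟩
  -- Uniqueness of weak gradients reduces linearity to the `L²` component.
  map_add' φ ψ := H1.ext_toL2 hΩ hb
    (MemLp.toLp_add (memLp_smoothFunctions hΩ hb φ) (memLp_smoothFunctions hΩ hb ψ))
  map_smul' c φ := H1.ext_toL2 hΩ hb (MemLp.toLp_const_smul c (memLp_smoothFunctions hΩ hb φ))

theorem coeFn_toL2_smoothToH1 (hΩ : IsOpen Ω) (hb : Bornology.IsBounded Ω)
    (φ : smoothFunctions) :
    H1.toL2 (smoothToH1 hΩ hb φ) =ᵐ[(volume : Measure E3).restrict Ω] φ.1 :=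
  MemLp.coeFn_toLp (memLp_smoothFunctions hΩ hb φ)

theorem coeFn_grad_smoothToH1 (hΩ : IsOpen Ω) (hb : Bornology.IsBounded Ω)
    (φ : smoothFunctions) :
    H1.grad (smoothToH1 hΩ hb φ) =ᵐ[(volume : Measure E3).restrict Ω] classicalGradient φ.1 :=
  MemLp.coeFn_toLp (memLp_classicalGradient hΩ hb φ)

/-- The trace inequality for the constant function 1 bounds the surface area by a multiple of the
volume. -/
theorem isFiniteMeasure_surfaceMeasure (hΩ : IsOpen Ω) (hne : Ω.Nonempty)
    (hb : Bornology.IsBounded Ω) (hs : StarShapedWrtBall Ω) :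
    IsFiniteMeasure (surfaceMeasure Ω) := by
  obtain ⟨C, hC⟩ := exists_lintegral_frontier_sq_le hΩ hne hb hs
  refine ⟨?_⟩
  have h := hC (fun _ => 1) contDiff_const
  have h0 : ‖(0 : E3 →L[ℝ] ℂ)‖ₑ = 0 := by
    rw [← ofReal_norm, norm_zero, ENNReal.ofReal_zero]
  simp only [fderiv_fun_const, Pi.zero_apply, enorm_one, one_pow, lintegral_const, one_mul, h0,
    zero_mul, add_zero, Measure.restrict_apply_univ] at h
  exact h.trans_lt (ENNReal.mul_lt_top ENNReal.coe_lt_top hb.measure_lt_top)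

theorem memLp_surfaceMeasure_smoothFunctions (hb : Bornology.IsBounded Ω)
    (hfin : IsFiniteMeasure (surfaceMeasure Ω)) (φ : smoothFunctions) :
    MemLp (φ : E3 → ℂ) 2 (surfaceMeasure Ω) :=
  memLp_restrict_of_continuous (contDiff_smoothFunctions φ (n := 0)).continuous
    isClosed_frontier.measurableSet (hb.closure.subset frontier_subset_closure) hfin 2

/-- The restriction to the boundary of smooth functions. -/
def smoothTrace (hb : Bornology.IsBounded Ω) (hfin : IsFiniteMeasure (surfaceMeasure Ω)) :
    smoothFunctions →ₗ[ℂ] L2Boundary Ω where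
  toFun φ := (memLp_surfaceMeasure_smoothFunctions hb hfin φ).toLp
  map_add' φ ψ := MemLp.toLp_add (memLp_surfaceMeasure_smoothFunctions hb hfin φ)
    (memLp_surfaceMeasure_smoothFunctions hb hfin ψ)
  map_smul' c φ := MemLp.toLp_const_smul c (memLp_surfaceMeasure_smoothFunctions hb hfin φ)

theorem coeFn_smoothTrace (hb : Bornology.IsBounded Ω)
    (hfin : IsFiniteMeasure (surfaceMeasure Ω)) (φ : smoothFunctions) :
    smoothTrace hb hfin φ =ᵐ[surfaceMeasure Ω] φ.1 :=
  MemLp.coeFn_toLp (memLp_surfaceMeasure_smoothFunctions hb hfin φ)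

theorem enorm_Lp_two_sq {F : Type*} [NormedAddCommGroup F] {μ : Measure E3} (f : Lp F 2 μ)
    {g : E3 → F} (h : f =ᵐ[μ] g) : ‖f‖ₑ ^ 2 = ∫⁻ x, ‖g x‖ₑ ^ 2 ∂μ := by
  have h1 := eLpNorm_nnreal_pow_eq_lintegral (f := g) (μ := μ) (p := 2) two_ne_zero
  rw [Lp.enorm_def, eLpNorm_congr_ae h]
  simpa using h1

theorem lintegral_mul_enorm_le_of_Lp_two {F F' : Type*} [NormedAddCommGroup F]
    [NormedAddCommGroup F'] {μ : Measure E3} (f : Lp F 2 μ) (g : Lp F' 2 μ) :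
    ∫⁻ x, ‖f x‖ₑ * ‖g x‖ₑ ∂μ ≤ ‖f‖ₑ * ‖g‖ₑ := by
  have h := ENNReal.lintegral_mul_le_Lp_mul_Lq μ Real.HolderConjugate.two_two
    (Lp.aestronglyMeasurable f).enorm (Lp.aestronglyMeasurable g).enorm
  simp only [Pi.mul_apply, ENNReal.rpow_two] at h
  rw [← enorm_Lp_two_sq f (Filter.EventuallyEq.refl _ _),
    ← enorm_Lp_two_sq g (Filter.EventuallyEq.refl _ _), ← ENNReal.rpow_two, ← ENNReal.rpow_two,
    ← ENNReal.rpow_mul, ← ENNReal.rpow_mul] at h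
  simpa using h

/-- Cauchy–Schwarz on the mixed integral. Keeping the product of the two norms, rather than the full
`H¹` norm, is what later permits a bound uniform in the wave number. -/
theorem exists_norm_smoothTrace_sq_le (hΩ : IsOpen Ω) (hne : Ω.Nonempty)
    (hb : Bornology.IsBounded Ω) (hs : StarShapedWrtBall Ω)
    (hfin : IsFiniteMeasure (surfaceMeasure Ω)) :
    ∃ C : NNReal, ∀ φ : smoothFunctions, ‖smoothTrace hb hfin φ‖ ^ 2 ≤
      C * (‖H1.toL2 (smoothToH1 hΩ hb φ)‖ ^ 2 +
        ‖H1.toL2 (smoothToH1 hΩ hb φ)‖ * ‖H1.grad (smoothToH1 hΩ hb φ)‖) := by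
  obtain ⟨C, hC⟩ := exists_lintegral_frontier_sq_le hΩ hne hb hs
  refine ⟨C, fun φ => ?_⟩
  have h := hC φ.1 (contDiff_smoothFunctions φ (n := 1))
  set u := smoothToH1 hΩ hb φ
  have h1 := enorm_Lp_two_sq (smoothTrace hb hfin φ) (coeFn_smoothTrace hb hfin φ)
  have h2 := enorm_Lp_two_sq (H1.toL2 u) (coeFn_toL2_smoothToH1 hΩ hb φ)
  have h3 : ∫⁻ y in Ω, ‖φ.1 y‖ₑ * ‖fderiv ℝ φ.1 y‖ₑ ≤ ‖H1.toL2 u‖ₑ * ‖H1.grad u‖ₑ := by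
    refine le_trans (lintegral_mono_ae ?_) (lintegral_mul_enorm_le_of_Lp_two _ _)
    filter_upwards [coeFn_toL2_smoothToH1 hΩ hb φ, coeFn_grad_smoothToH1 hΩ hb φ] with x hx hx'
    rw [hx, hx']
    gcongr
    rw [← ofReal_norm, ← ofReal_norm]
    exact ENNReal.ofReal_le_ofReal (norm_fderiv_le_norm_classicalGradient _ _)
  have h4 : ‖smoothTrace hb hfin φ‖ₑ ^ 2 ≤
      C * (‖H1.toL2 u‖ₑ ^ 2 + ‖H1.toL2 u‖ₑ * ‖H1.grad u‖ₑ) := by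
    rw [h1, h2]
    refine h.trans ?_
    gcongr
  have h5 := ENNReal.toReal_mono (by finiteness) h4
  rw [ENNReal.toReal_mul, ENNReal.toReal_add (by finiteness) (by finiteness)] at h5
  simpa using h5

end RobinHelmholtz
end

/-! ### Averages over contractions and their `L²` convergence -/

noncomputable section

namespace RobinHelmholtz

open Metric Set Filter Topology

variable {F : Type*} [NormedAddCommGroup F] [NormedSpace ℝ F]

/-- The contraction of `ℝ³` towards `z` with factor `1 - ε`. -/
def contraction (ε : ℝ) (x z : E3) : E3 := (1 - ε) • x + ε • z

theorem measurable_contraction (ε : ℝ) : Measurable fun p : E3 × E3 => contraction ε p.1 p.2 := by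
  unfold contraction
  fun_prop

/-- The average of `f ∘ contraction ε · z` over `z` with weight `η`: a mollification of `f` that
only uses values of `f` near the contraction of the point of evaluation. -/
def contractionAverage (η : E3 → ℝ) (ε : ℝ) (f : E3 → F) (x : E3) : F :=
  ∫ z, η z • f (contraction ε x z)

/-- The change of variables has Jacobian factor `(1 - ε)⁻³ ≤ 8`, independent of `z`. -/
theorem lintegral_comp_contraction_le {H : E3 → ENNReal} (hH : Measurable H) {ε : ℝ}
    (hε : ε ≤ 1 / 2) (z : E3) : ∫⁻ x, H (contraction ε x z) ≤ 8 * ∫⁻ x, H x := by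
  have h0 : (0 : ℝ) < 1 - ε := by linarith
  have hm : Measurable fun x => H (x + ε • z) := hH.comp (measurable_id.add_const _)
  simp only [contraction]
  rw [← lintegral_map (g := fun x : E3 => (1 - ε) • x) hm (measurable_const_smul (1 - ε)),
    Measure.map_addHaar_smul _ h0.ne', lintegral_smul_measure, finrank_euclideanSpace_fin,
    smul_eq_mul, lintegral_add_right_eq_self]
  gcongr
  have h8 : (8 : ENNReal) = ENNReal.ofReal 8 := by norm_num
  rw [h8, abs_of_pos (by positivity)]
  refine ENNReal.ofReal_le_ofReal ?_
  rw [inv_le_comm₀ (by positivity) (by norm_num)]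
  calc (8 : ℝ)⁻¹ = (1 / 2) ^ 3 := by norm_num
    _ ≤ (1 - ε) ^ 3 := by gcongr; linarith

theorem enorm_sub_sq_le_three {F : Type*} [NormedAddCommGroup F] (a b c d : F) :
    ‖a - d‖ₑ ^ 2 ≤ 3 * (‖a - b‖ₑ ^ 2 + ‖b - c‖ₑ ^ 2 + ‖c - d‖ₑ ^ 2) := by
  have h : ‖a - d‖ ^ 2 ≤ 3 * (‖a - b‖ ^ 2 + ‖b - c‖ ^ 2 + ‖c - d‖ ^ 2) := by
    have h1 : ‖a - d‖ ≤ ‖a - b‖ + ‖b - c‖ + ‖c - d‖ := by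
      have := norm_add₃_le (a := a - b) (b := b - c) (c := c - d)
      simpa using this
    calc ‖a - d‖ ^ 2 ≤ (‖a - b‖ + ‖b - c‖ + ‖c - d‖) ^ 2 := by gcongr
      _ ≤ _ := by
        nlinarith [sq_nonneg (‖a - b‖ - ‖b - c‖), sq_nonneg (‖b - c‖ - ‖c - d‖),
          sq_nonneg (‖a - b‖ - ‖c - d‖)]
  have h2 := ENNReal.ofReal_le_ofReal h
  rw [ENNReal.ofReal_mul (by norm_num), ENNReal.ofReal_add (by positivity) (by positivity),
    ENNReal.ofReal_add (by positivity) (by positivity)] at h2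
  simpa [ENNReal.ofReal_pow] using h2

/-- Contractions act continuously in `L²`, uniformly in the centre of the contraction. -/
theorem eventually_lintegral_contraction_sub_sq_le [MeasurableSpace F] [BorelSpace F]
    [SecondCountableTopology F] {f : E3 → F} (hfm : StronglyMeasurable f)
    (hf : MemLp f 2 volume) {S B : Set E3}
    (hSm : MeasurableSet S) (hS : Bornology.IsBounded S) (hB : Bornology.IsBounded B)
    {δ : ENNReal} (hδ : 0 < δ) :
    ∀ᶠ ε in 𝓝[>] (0 : ℝ), ∀ z ∈ B, ∫⁻ x in S, ‖f (contraction ε x z) - f x‖ₑ ^ 2 ≤ δ := by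
  rcases eq_or_ne δ ⊤ with rfl | hδt
  · simp
  -- `f` is replaced by a continuous compactly supported `g` with `L²` error `e`. Here `27 = 3 * (8
  -- + 1)`: 3 from squaring a sum of three terms, 8 for the contracted error and 1 for the error
  -- itself.
  obtain ⟨e, he0, he⟩ : ∃ e : ENNReal, e ≠ 0 ∧ 27 * e ^ 2 ≤ δ / 2 := by
    have h1 : Tendsto (fun e : ENNReal => 27 * e ^ 2) (𝓝[>] 0) (𝓝 0) := by
      have : Tendsto (fun e : ENNReal => 27 * e ^ 2) (𝓝 0) (𝓝 (27 * 0 ^ 2)) :=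
        ENNReal.Tendsto.const_mul ((ENNReal.continuous_pow 2).tendsto 0) (Or.inr (by norm_num))
      simpa using this.mono_left nhdsWithin_le_nhds
    have h2 := (h1.eventually_le_const (ENNReal.half_pos hδ.ne')).and self_mem_nhdsWithin
    obtain ⟨e, h, h'⟩ := h2.exists
    exact ⟨e, ne_of_gt h', h⟩
  obtain ⟨g, hgc, hfg, hg, -⟩ := hf.exists_hasCompactSupport_eLpNorm_sub_le (by norm_num) he0
  have hfg2 : ∫⁻ x, ‖f x - g x‖ₑ ^ 2 ≤ e ^ 2 := by
    have := eLpNorm_nnreal_pow_eq_lintegral (f := f - g) (μ := volume) (p := 2) two_ne_zero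
    simp only [NNReal.coe_ofNat, ENNReal.coe_ofNat, ENNReal.rpow_two, Pi.sub_apply] at this
    rw [← this]
    gcongr
  obtain ⟨τ, hτ0, hτ⟩ : ∃ τ : ℝ, 0 < τ ∧ 3 * (ENNReal.ofReal τ ^ 2 * volume S) ≤ δ / 2 := by
    have h1 : Tendsto (fun τ : ℝ => 3 * (ENNReal.ofReal τ ^ 2 * volume S)) (𝓝[>] 0) (𝓝 0) := by
      have : Tendsto (fun τ : ℝ => 3 * (ENNReal.ofReal τ ^ 2 * volume S)) (𝓝 0)
          (𝓝 (3 * (ENNReal.ofReal 0 ^ 2 * volume S))) :=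
        ENNReal.Tendsto.const_mul (ENNReal.Tendsto.mul_const
          (((ENNReal.continuous_pow 2).comp ENNReal.continuous_ofReal).tendsto 0)
          (Or.inr hS.measure_lt_top.ne)) (Or.inr (by norm_num))
      simpa using this.mono_left nhdsWithin_le_nhds
    have h2 := (h1.eventually_le_const (ENNReal.half_pos hδ.ne')).and self_mem_nhdsWithin
    obtain ⟨τ, h, h'⟩ := h2.exists
    exact ⟨τ, h', h⟩
  obtain ⟨d, hd0, hd⟩ := Metric.uniformContinuous_iff.1
    (hg.uniformContinuous_of_tendsto_cocompact (hgc.is_zero_at_infty)) τ hτ0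
  obtain ⟨M, hM⟩ := (hS.union hB).exists_norm_le
  have hM0 : 0 ≤ |M| := abs_nonneg M
  have hlim : ∀ᶠ ε in 𝓝[>] (0 : ℝ), ε * (2 * |M|) < d := by
    have : Tendsto (fun ε : ℝ => ε * (2 * |M|)) (𝓝 0) (𝓝 (0 * (2 * |M|))) :=
      tendsto_id.mul_const _
    rw [zero_mul] at this
    exact (this.mono_left nhdsWithin_le_nhds).eventually_lt_const hd0
  have hhalf : ∀ᶠ ε in 𝓝[>] (0 : ℝ), ε ≤ 1 / 2 :=
    nhdsWithin_le_nhds (Iic_mem_nhds (by norm_num))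
  filter_upwards [hlim, hhalf, self_mem_nhdsWithin] with ε hε hε2 hε0 z hz
  have hε0' : 0 < ε := hε0
  -- The contraction moves `x` by `ε (z - x)`, uniformly small on `S × B`, so uniform continuity of
  -- `g` applies.
  have hgclose : ∀ x ∈ S, ‖g (contraction ε x z) - g x‖ₑ ≤ ENNReal.ofReal τ := by
    intro x hx
    rw [← ofReal_norm, ← dist_eq_norm]
    refine ENNReal.ofReal_le_ofReal (hd ?_).le
    have : contraction ε x z - x = ε • (z - x) := by
      rw [contraction, sub_smul, smul_sub, one_smul]; abel
    rw [dist_eq_norm, this, norm_smul, Real.norm_of_nonneg hε0'.le]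
    refine lt_of_le_of_lt ?_ hε
    gcongr
    have h1 := (hM x (Or.inl hx)).trans (le_abs_self M)
    have h2 := (hM z (Or.inr hz)).trans (le_abs_self M)
    linarith [norm_sub_le z x]
  have hm1 : Measurable fun x => ‖f x - g x‖ₑ ^ 2 :=
    ((hfm.sub hg.stronglyMeasurable).measurable.enorm).pow_const 2
  have hcm : Measurable fun x => contraction ε x z :=
    (measurable_const_smul _).add_const _
  calc ∫⁻ x in S, ‖f (contraction ε x z) - f x‖ₑ ^ 2
      ≤ ∫⁻ x in S, 3 * (‖f (contraction ε x z) - g (contraction ε x z)‖ₑ ^ 2 +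
          ENNReal.ofReal τ ^ 2 + ‖f x - g x‖ₑ ^ 2) := by
        refine setLIntegral_mono' hSm fun x hx => ?_
        refine (enorm_sub_sq_le_three _ (g (contraction ε x z)) (g x) _).trans ?_
        rw [enorm_sub_rev (g x) (f x)]
        gcongr
        exact hgclose x hx
    _ = 3 * ((∫⁻ x in S, ‖f (contraction ε x z) - g (contraction ε x z)‖ₑ ^ 2) +
          ENNReal.ofReal τ ^ 2 * volume S + ∫⁻ x in S, ‖f x - g x‖ₑ ^ 2) := by
        rw [lintegral_const_mul' _ _ (by norm_num), lintegral_add_right _ hm1,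
          lintegral_add_right _ measurable_const, setLIntegral_const]
    _ ≤ 3 * (8 * e ^ 2 + ENNReal.ofReal τ ^ 2 * volume S + e ^ 2) := by
        gcongr
        · refine (setLIntegral_le_lintegral _ _).trans
            ((lintegral_comp_contraction_le hm1 hε2 z).trans ?_)
          gcongr
        · exact (setLIntegral_le_lintegral _ _).trans hfg2
    _ = 27 * e ^ 2 + 3 * (ENNReal.ofReal τ ^ 2 * volume S) := by ring
    _ ≤ δ / 2 + δ / 2 := by gcongr
    _ = δ := ENNReal.add_halves δ

theorem integrable_smul_comp_contraction {f : E3 → F} (hf : Integrable f) {η : E3 → ℝ}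
    (hη : Continuous η) (hηc : HasCompactSupport η) {ε : ℝ} (hε : ε ≠ 0) (x : E3) :
    Integrable fun z => η z • f (contraction ε x z) := by
  have h : Integrable fun z => f (contraction ε x z) :=
    (hf.comp_add_left ((1 - ε) • x)).comp_smul hε
  exact h.smul_of_top_right (hη.memLp_top_of_hasCompactSupport hηc volume)

/-- A weighted average is bounded in the square by the average of the squares. -/
theorem enorm_integral_smul_sq_le {η : E3 → ℝ} (hη : Continuous η) (hη0 : ∀ z, 0 ≤ η z)
    (hη1 : ∫ z, η z = 1) (hηi : Integrable η) {h : E3 → F} (hh : AEMeasurable (fun z => ‖h z‖ₑ)) :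
    ‖∫ z, η z • h z‖ₑ ^ 2 ≤ ∫⁻ z, ENNReal.ofReal (η z) * ‖h z‖ₑ ^ 2 := by
  have hw : ∫⁻ z, ENNReal.ofReal (η z) = 1 := by
    rw [← ofReal_integral_eq_lintegral_ofReal hηi (Eventually.of_forall hη0), hη1,
      ENNReal.ofReal_one]
  have hwm : Measurable fun z => ENNReal.ofReal (η z) := hη.measurable.ennreal_ofReal
  have h1 : ‖∫ z, η z • h z‖ₑ ≤ ∫⁻ z, ENNReal.ofReal (η z) * ‖h z‖ₑ := by
    refine (enorm_integral_le_lintegral_enorm _).trans (le_of_eq (lintegral_congr fun z => ?_))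
    rw [enorm_smul, Real.enorm_eq_ofReal (hη0 z)]
  -- The weight is split as `η^{1/2} · η^{1/2}`; one half integrates to 1.
  have h2 := ENNReal.lintegral_mul_le_Lp_mul_Lq volume Real.HolderConjugate.two_two
    (f := fun z => ENNReal.ofReal (η z) ^ (1 / 2 : ℝ))
    (g := fun z => ENNReal.ofReal (η z) ^ (1 / 2 : ℝ) * ‖h z‖ₑ)
    (hwm.pow_const _).aemeasurable ((hwm.pow_const _).aemeasurable.mul hh)
  have hsq : ∀ a : ENNReal, (a ^ (1 / 2 : ℝ)) ^ (2 : ℝ) = a := fun a => by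
    rw [← ENNReal.rpow_mul]; norm_num
  have hmul : ∀ a : ENNReal, a ^ (1 / 2 : ℝ) * a ^ (1 / 2 : ℝ) = a := fun a => by
    rw [← sq, ← ENNReal.rpow_two, hsq]
  simp only [Pi.mul_apply, ← mul_assoc, hmul, ENNReal.mul_rpow_of_nonneg _ _ zero_le_two, hsq, hw,
    ENNReal.one_rpow, one_mul] at h2
  calc ‖∫ z, η z • h z‖ₑ ^ 2 ≤ ((∫⁻ z, ENNReal.ofReal (η z) * ‖h z‖ₑ ^ (2 : ℝ)) ^ (1 / 2 : ℝ)) ^ 2 := by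
        gcongr
        exact h1.trans h2
    _ = _ := by
        rw [← ENNReal.rpow_two, hsq]
        simp only [ENNReal.rpow_two]

/-- Averages over contractions converge in `L²` to the identity. -/
theorem tendsto_lintegral_contractionAverage_sub [CompleteSpace F]
    [MeasurableSpace F] [BorelSpace F]
    [SecondCountableTopology F] {f : E3 → F} (hfm : StronglyMeasurable f) (hf : MemLp f 2 volume)
    (hfi : Integrable f) {η : E3 → ℝ} (hη : Continuous η) (hηc : HasCompactSupport η)
    (hη0 : ∀ z, 0 ≤ η z) (hη1 : ∫ z, η z = 1) {S : Set E3} (hSm : MeasurableSet S)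
    (hS : Bornology.IsBounded S) :
    Tendsto (fun ε => ∫⁻ x in S, ‖contractionAverage η ε f x - f x‖ₑ ^ 2) (𝓝[>] 0) (𝓝 0) := by
  rw [ENNReal.tendsto_nhds_zero]
  intro δ hδ
  have hηi : Integrable η := hη.integrable_of_hasCompactSupport hηc
  filter_upwards [eventually_lintegral_contraction_sub_sq_le hfm hf hSm hS hηc.isBounded hδ,
    self_mem_nhdsWithin] with ε hε hε0
  have hε0' : ε ≠ 0 := ne_of_gt hε0
  have hw : ∫⁻ z, ENNReal.ofReal (η z) = 1 := by
    rw [← ofReal_integral_eq_lintegral_ofReal hηi (Eventually.of_forall hη0), hη1,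
      ENNReal.ofReal_one]
  have hwm : Measurable fun z => ENNReal.ofReal (η z) := hη.measurable.ennreal_ofReal
  have hjm : Measurable fun p : E3 × E3 => ‖f (contraction ε p.1 p.2) - f p.1‖ₑ ^ 2 :=
    (((hfm.measurable.comp (measurable_contraction ε)).sub
      (hfm.measurable.comp measurable_fst)).enorm).pow_const 2
  have hpt : ∀ x, ‖contractionAverage η ε f x - f x‖ₑ ^ 2 ≤
      ∫⁻ z, ENNReal.ofReal (η z) * ‖f (contraction ε x z) - f x‖ₑ ^ 2 := by
    intro x
    have h1 : contractionAverage η ε f x - f x = ∫ z, η z • (f (contraction ε x z) - f x) := by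
      simp only [smul_sub]
      rw [integral_sub (integrable_smul_comp_contraction hfi hη hηc hε0' x)
        (hηi.smul_const _), integral_smul_const, hη1, one_smul, contractionAverage]
    rw [h1]
    refine enorm_integral_smul_sq_le hη hη0 hη1 hηi ?_
    exact ((hfm.measurable.comp ((measurable_contraction ε).comp
      measurable_prodMk_left)).sub_const _).enorm.aemeasurable
  calc ∫⁻ x in S, ‖contractionAverage η ε f x - f x‖ₑ ^ 2
      ≤ ∫⁻ x in S, ∫⁻ z, ENNReal.ofReal (η z) * ‖f (contraction ε x z) - f x‖ₑ ^ 2 :=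
        lintegral_mono hpt
    -- Tonelli puts `z` outside, where the inner integral is at most `δ` uniformly on the support of
    -- `η`.
    _ = ∫⁻ z, ∫⁻ x in S, ENNReal.ofReal (η z) * ‖f (contraction ε x z) - f x‖ₑ ^ 2 :=
        lintegral_lintegral_swap (((hwm.comp measurable_snd).mul hjm).aemeasurable)
    _ = ∫⁻ z, ENNReal.ofReal (η z) * ∫⁻ x in S, ‖f (contraction ε x z) - f x‖ₑ ^ 2 := by
        simp only [lintegral_const_mul' _ _ ENNReal.ofReal_ne_top]
    _ ≤ ∫⁻ z, ENNReal.ofReal (η z) * δ := by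
        refine lintegral_mono fun z => ?_
        by_cases hz : z ∈ tsupport η
        · exact mul_le_mul_right (hε z hz) _
        · simp [image_eq_zero_of_notMem_tsupport hz]
    _ = δ := by rw [lintegral_mul_const _ hwm, hw, one_mul]

end RobinHelmholtz
end

/-! ### Smoothness and gradient of the averages -/

noncomputable section

namespace RobinHelmholtz

open Metric Set Filter Topology
open scoped Convolution

variable {Ω : Set E3}

/-- The rescaled and reflected kernel whose convolution is `contractionAverage`. -/
def contractionKernel (η : E3 → ℝ) (ε : ℝ) (t : E3) : ℝ := (ε ^ 3)⁻¹ * η ((-ε)⁻¹ • t)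

theorem contDiff_contractionKernel {η : E3 → ℝ} (hη : ContDiff ℝ ∞ η) (ε : ℝ) :
    ContDiff ℝ ∞ (contractionKernel η ε) :=
  contDiff_const.mul (hη.comp (contDiff_const_smul _))

theorem hasCompactSupport_contractionKernel {η : E3 → ℝ} (hηc : HasCompactSupport η) {ε : ℝ}
    (hε : 0 < ε) : HasCompactSupport (contractionKernel η ε) :=
  (hηc.comp_smul (c := (-ε)⁻¹) (inv_ne_zero (neg_ne_zero.2 hε.ne'))).mul_left

/-- The substitution `t = -εz`, after which the smoothness of convolutions is available. -/
theorem contractionAverage_eq_convolution {F : Type*} [NormedAddCommGroup F] [NormedSpace ℝ F]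
    [CompleteSpace F]
    (η : E3 → ℝ) {ε : ℝ} (hε : 0 < ε) (f : E3 → F) (x : E3) :
    contractionAverage η ε f x =
      (contractionKernel η ε ⋆[ContinuousLinearMap.lsmul ℝ ℝ, volume] f) ((1 - ε) • x) := by
  have h := Measure.integral_comp_smul (volume : Measure E3)
    (fun t => contractionKernel η ε t • f ((1 - ε) • x - t)) (-ε)
  have h1 : ∀ z, contractionKernel η ε (-ε • z) • f ((1 - ε) • x - -ε • z) =
      (ε ^ 3)⁻¹ • (η z • f (contraction ε x z)) := by
    intro z
    rw [contractionKernel, smul_smul, inv_mul_cancel₀ (neg_ne_zero.2 hε.ne'), one_smul, mul_smul,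
      neg_smul, sub_neg_eq_add, contraction]
  simp only [h1] at h
  have h2 : |((-ε) ^ 3)⁻¹| = (ε ^ 3)⁻¹ := by
    rw [abs_inv, abs_pow, abs_neg, abs_of_pos hε]
  rw [finrank_euclideanSpace_fin, h2, integral_smul] at h
  simpa [convolution_def, contractionAverage] using smul_right_injective F (by positivity : (ε ^ 3)⁻¹ ≠ 0) h

/-- Averages over contractions of integrable functions are smooth. -/
theorem contDiff_contractionAverage {u : E3 → ℂ} (hu : Integrable u) {η : E3 → ℝ}
    (hη : ContDiff ℝ ∞ η) (hηc : HasCompactSupport η) {ε : ℝ} (hε : 0 < ε) :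
    ContDiff ℝ ∞ (contractionAverage η ε u) := by
  have h := (hasCompactSupport_contractionKernel hηc hε).contDiff_convolution_left
    (ContinuousLinearMap.lsmul ℝ ℝ) (contDiff_contractionKernel hη ε) hu.locallyIntegrable
    (μ := volume)
  have h2 : contractionAverage η ε u = fun x =>
      (contractionKernel η ε ⋆[ContinuousLinearMap.lsmul ℝ ℝ, volume] u) ((1 - ε) • x) :=
    funext fun x => contractionAverage_eq_convolution η hε u x
  rw [h2]
  exact h.comp (contDiff_const_smul _)

/-- The support lies in the set of points `(1 - ε)x + εz` with `z` in the support of `η`. Each such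
`z` is a star centre, so these points stay in `Ω`; this is where star-shapedness enters the density
proof. -/
theorem isTestFunction_contractionKernel_sub {η : E3 → ℝ}
    (hη : ContDiff ℝ ∞ η) (hηc : HasCompactSupport η) {ε : ℝ} (hε : 0 < ε) (hε1 : ε < 1)
    (hstar : ∀ z ∈ tsupport η, StarConvex ℝ z Ω) {x : E3} (hx : x ∈ Ω) :
    IsTestFunction Ω fun w => contractionKernel η ε ((1 - ε) • x - w) := by
  have hK : IsCompact (contraction ε x '' tsupport η) :=
    hηc.isCompact.image (by unfold contraction; fun_prop)
  have hsupp : Function.support (fun w => contractionKernel η ε ((1 - ε) • x - w)) ⊆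
      contraction ε x '' tsupport η := by
    intro w hw
    refine ⟨(-ε)⁻¹ • ((1 - ε) • x - w), subset_tsupport _ (right_ne_zero_of_mul hw), ?_⟩
    rw [contraction, smul_smul, inv_neg, mul_neg, mul_inv_cancel₀ hε.ne', neg_one_smul]
    abel
  refine ⟨(contDiff_contractionKernel hη ε).comp (contDiff_const.sub contDiff_id),
    HasCompactSupport.of_support_subset_isCompact hK hsupp, ?_⟩
  refine (closure_minimal hsupp hK.isClosed).trans ?_
  rintro _ ⟨z, hz, rfl⟩
  rw [contraction, add_comm]
  exact hstar z hz hx hε.le (by linarith) (by ring)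

/-- On `Ω`, the gradient of the average of a function over contractions is the average of its weak
gradient. -/
theorem classicalGradient_contractionAverage (hΩ : IsOpen Ω) {u : E3 → ℂ}
    {G : E3 → EuclideanSpace ℂ (Fin 3)} (huG : IsWeakGradient Ω u G)
    (hu : Integrable (Ω.indicator u)) (hG : Integrable (Ω.indicator G)) {η : E3 → ℝ}
    (hη : ContDiff ℝ ∞ η) (hηc : HasCompactSupport η) {ε : ℝ} (hε : 0 < ε) (hε1 : ε < 1)
    (hstar : ∀ z ∈ tsupport η, StarConvex ℝ z Ω) {x : E3} (hx : x ∈ Ω) :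
    classicalGradient (contractionAverage η ε (Ω.indicator u)) x =
      (1 - ε) • contractionAverage η ε (Ω.indicator G) x := by
  set k := contractionKernel η ε with hk
  have hkc : HasCompactSupport k := hasCompactSupport_contractionKernel hηc hε
  have hkd : ContDiff ℝ ∞ k := contDiff_contractionKernel hη ε
  have hkd1 : ContDiff ℝ 1 k := hkd.of_le (by simp)
  set y := (1 - ε) • x with hy
  set L : ℝ →L[ℝ] ℂ →L[ℝ] ℂ := ContinuousLinearMap.lsmul ℝ ℝ with hL
  have hconv := hkc.hasFDerivAt_convolution_left L hkd1 hu.locallyIntegrable (μ := volume) y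
  have h2 : contractionAverage η ε (Ω.indicator u) =
      fun x => (k ⋆[L, volume] Ω.indicator u) ((1 - ε) • x) :=
    funext fun x => contractionAverage_eq_convolution η hε _ x
  -- The chain rule for this dilation is the source of the factor `1 - ε`.
  have hsm : HasFDerivAt (fun x : E3 => (1 - ε) • x)
      ((1 - ε) • ContinuousLinearMap.id ℝ E3) x := (hasFDerivAt_id x).const_smul (1 - ε)
  have hfd : HasFDerivAt (contractionAverage η ε (Ω.indicator u))
      (((fderiv ℝ k ⋆[L.precompL E3, volume] Ω.indicator u) y).comp
        ((1 - ε) • ContinuousLinearMap.id ℝ E3)) x := by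
    rw [h2]; exact hconv.comp x hsm
  -- Differentiating the convolution puts the derivative on the kernel; up to sign this is a
  -- derivative of the test function `ψ`, which the weak gradient identity transfers to `G`.
  set ψ : E3 → ℝ := fun w => k (y - w) with hψ
  have htest : IsTestFunction Ω ψ := isTestFunction_contractionKernel_sub hη hηc hε hε1 hstar hx
  have hψd : ∀ i w, partialDeriv i ψ w = - fderiv ℝ k (y - w) (EuclideanSpace.single i 1) := by
    intro i w
    have h3 : HasFDerivAt ψ _ w := ((hkd1.differentiable one_ne_zero).differentiableAt.hasFDerivAt
      (x := y - w)).comp w ((hasFDerivAt_id w).const_sub y)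
    rw [partialDeriv, h3.fderiv]
    simp
  ext i
  have hconvG : contractionAverage η ε (Ω.indicator G) x i = ∫ w in Ω, ψ w • G w i := by
    have h3 := contractionAverage_eq_convolution η hε (Ω.indicator G) x
    rw [convolution_def] at h3
    have hint : Integrable fun w => ψ w • (Ω.indicator G) w :=
      hG.smul_of_top_right (htest.1.continuous.memLp_top_of_hasCompactSupport htest.2.1 volume)
    have h4 : contractionAverage η ε (Ω.indicator G) x = ∫ w, ψ w • (Ω.indicator G) w := by
      rw [h3, ← integral_sub_left_eq_self _ volume y]
      simp [hψ, hk, hy]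
    rw [h4, ← integral_indicator hΩ.measurableSet]
    have h5 := ((EuclideanSpace.proj i : EuclideanSpace ℂ (Fin 3) →L[ℂ] ℂ).restrictScalars
      ℝ).integral_comp_comm hint
    simp only [ContinuousLinearMap.coe_restrictScalars', PiLp.proj_apply] at h5
    rw [← h5]
    refine integral_congr_ae (Eventually.of_forall fun w => ?_)
    by_cases hw : w ∈ Ω
    · simp [hw]
    · simp [hw]
  have hconvu : (fderiv ℝ k ⋆[L.precompL E3, volume] Ω.indicator u) y (EuclideanSpace.single i 1)
      = - ∫ w in Ω, partialDeriv i ψ w • u w := by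
    have hint : Integrable fun t => L.precompL E3 (fderiv ℝ k t) (Ω.indicator u (y - t)) :=
      (hkc.fderiv ℝ).convolutionExists_left (L.precompL E3) (hkd1.continuous_fderiv one_ne_zero)
        hu.locallyIntegrable y
    rw [convolution_def, ContinuousLinearMap.integral_apply hint,
      ← integral_sub_left_eq_self _ volume y, ← integral_neg, ← integral_indicator hΩ.measurableSet]
    refine integral_congr_ae (Eventually.of_forall fun w => ?_)
    by_cases hw : w ∈ Ω
    · simp [hw, hψd, hL, ContinuousLinearMap.precompL_apply]
    · simp [hw]
  rw [classicalGradient, hfd.fderiv]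
  simp only [ContinuousLinearMap.comp_apply, _root_.smul_apply,
    ContinuousLinearMap.id_apply, map_smul, hconvu, huG ψ htest i, neg_neg, PiLp.smul_apply, hconvG]

end RobinHelmholtz
end

/-! ### Density of smooth functions in `H¹(Ω)` -/

noncomputable section

namespace RobinHelmholtz

open Metric Set Filter Topology

variable {Ω : Set E3}

theorem tendsto_norm_Lp_two_sub_of_tendsto_lintegral {F ι : Type*} [NormedAddCommGroup F]
    {μ : Measure E3} {l : Filter ι} {v : ι → Lp F 2 μ} {w : Lp F 2 μ} {g : ι → E3 → F}
    {g₀ : E3 → F} (hg : ∀ᶠ i in l, v i =ᵐ[μ] g i) (hg₀ : w =ᵐ[μ] g₀)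
    (h : Tendsto (fun i => ∫⁻ x, ‖g i x - g₀ x‖ₑ ^ 2 ∂μ) l (𝓝 0)) :
    Tendsto v l (𝓝 w) := by
  rw [tendsto_iff_norm_sub_tendsto_zero]
  have h1 : Tendsto (fun i => ‖v i - w‖ₑ ^ 2) l (𝓝 0) := by
    refine h.congr' ?_
    filter_upwards [hg] with i hi
    refine (enorm_Lp_two_sq (v i - w) ?_).symm
    filter_upwards [hi, hg₀, Lp.coeFn_sub (v i) w] with x h1 h2 h3
    rw [h3, Pi.sub_apply, h1, h2]
  have h2 := (ENNReal.tendsto_toReal ENNReal.zero_ne_top).comp h1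
  have h3 := (Real.continuous_sqrt.tendsto _).comp h2
  simpa [Function.comp_def, Real.sqrt_sq] using h3

/-- Smooth functions are dense in `H¹(Ω)` for bounded domains that are star-shaped with respect to
a ball. -/
theorem denseRange_smoothToH1 (hΩ : IsOpen Ω) (hb : Bornology.IsBounded Ω)
    (hs : StarShapedWrtBall Ω) : DenseRange (smoothToH1 hΩ hb) := by
  obtain ⟨x₀, r, hr, hstar⟩ := hs
  have := isFiniteMeasure_restrict_of_isBounded hb
  -- Outer radius `r / 2` keeps the closed support of the weight inside the open ball of star
  -- centres.
  let b : ContDiffBump x₀ := ⟨r / 4, r / 2, by positivity, by linarith⟩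
  set η : E3 → ℝ := b.normed volume with hη
  have hηd : ContDiff ℝ ∞ η := b.contDiff_normed
  have hηc : HasCompactSupport η := b.hasCompactSupport_normed
  have hη0 : ∀ z, 0 ≤ η z := fun z => b.nonneg_normed z
  have hη1 : ∫ z, η z = 1 := b.integral_normed
  have hηs : ∀ z ∈ tsupport η, StarConvex ℝ z Ω := by
    intro z hz
    rw [hη, b.tsupport_normed_eq] at hz
    exact hstar z (closedBall_subset_ball (show r / 2 < r by linarith) hz)
  intro u
  set U : E3 → ℂ := Ω.indicator (H1.toL2 u) with hU
  set V : E3 → EuclideanSpace ℂ (Fin 3) := Ω.indicator (H1.grad u) with hV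
  have hUm : StronglyMeasurable U := (Lp.stronglyMeasurable _).indicator hΩ.measurableSet
  have hVm : StronglyMeasurable V := (Lp.stronglyMeasurable _).indicator hΩ.measurableSet
  have hU2 : MemLp U 2 volume := (memLp_indicator_iff_restrict hΩ.measurableSet).2 (Lp.memLp _)
  have hV2 : MemLp V 2 volume := (memLp_indicator_iff_restrict hΩ.measurableSet).2 (Lp.memLp _)
  have hU1 : Integrable U := (integrable_indicator_iff hΩ.measurableSet).2
    ((Lp.memLp (H1.toL2 u)).integrable one_le_two)
  have hV1 : Integrable V := (integrable_indicator_iff hΩ.measurableSet).2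
    ((Lp.memLp (H1.grad u)).integrable one_le_two)
  have hUu : H1.toL2 u =ᵐ[(volume : Measure E3).restrict Ω] U :=
    (indicator_ae_eq_restrict hΩ.measurableSet).symm
  have hVu : H1.grad u =ᵐ[(volume : Measure E3).restrict Ω] V :=
    (indicator_ae_eq_restrict hΩ.measurableSet).symm
  have hsm : ∀ ε : ℝ, ∃ φ : smoothFunctions, 0 < ε → φ.1 = contractionAverage η ε U := by
    intro ε
    by_cases hε : 0 < ε
    · exact ⟨⟨_, contDiff_contractionAverage hU1 hηd hηc hε⟩, fun _ => rfl⟩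
    · exact ⟨0, fun h => absurd h hε⟩
  choose φ hφ using hsm
  have hlimU := tendsto_lintegral_contractionAverage_sub hUm hU2 hU1 hηd.continuous hηc hη0 hη1
    hΩ.measurableSet hb
  have hlimV := tendsto_lintegral_contractionAverage_sub hVm hV2 hV1 hηd.continuous hηc hη0 hη1
    hΩ.measurableSet hb
  have hlt1 : ∀ᶠ ε in 𝓝[>] (0 : ℝ), ε < 1 := nhdsWithin_le_nhds (Iio_mem_nhds one_pos)
  have htoL2 : Tendsto (fun ε => H1.toL2 (smoothToH1 hΩ hb (φ ε))) (𝓝[>] 0) (𝓝 (H1.toL2 u)) := by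
    refine tendsto_norm_Lp_two_sub_of_tendsto_lintegral ?_ hUu hlimU
    filter_upwards [self_mem_nhdsWithin] with ε hε
    rw [← hφ ε hε]
    exact coeFn_toL2_smoothToH1 hΩ hb (φ ε)
  have hgrad : Tendsto (fun ε => H1.grad (smoothToH1 hΩ hb (φ ε))) (𝓝[>] 0) (𝓝 (H1.grad u)) := by
    -- Rescaling removes the factor `1 - ε`, leaving exactly the average of the weak gradient.
    have h1 : Tendsto (fun ε => (1 - ε)⁻¹ • H1.grad (smoothToH1 hΩ hb (φ ε))) (𝓝[>] 0)
        (𝓝 (H1.grad u)) := by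
      refine tendsto_norm_Lp_two_sub_of_tendsto_lintegral ?_ hVu hlimV
      filter_upwards [self_mem_nhdsWithin, hlt1] with ε hε hε1
      filter_upwards [Lp.coeFn_smul (1 - ε)⁻¹ (H1.grad (smoothToH1 hΩ hb (φ ε))),
        coeFn_grad_smoothToH1 hΩ hb (φ ε), ae_restrict_mem hΩ.measurableSet] with x h2 h3 hx
      rw [h2, Pi.smul_apply, h3, hφ ε hε, classicalGradient_contractionAverage hΩ (u := H1.toL2 u)
        (G := H1.grad u) u.2 hU1 hV1 hηd hηc hε hε1 hηs hx, smul_smul, inv_mul_cancel₀ (by linarith), one_smul]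
    have h2 : Tendsto (fun ε : ℝ => 1 - ε) (𝓝[>] 0) (𝓝 1) := by
      have : Tendsto (fun ε : ℝ => 1 - ε) (𝓝 0) (𝓝 (1 - 0)) := tendsto_const_nhds.sub tendsto_id
      rw [sub_zero] at this
      exact this.mono_left nhdsWithin_le_nhds
    have h3 := h2.smul h1
    rw [one_smul] at h3
    refine h3.congr' ?_
    filter_upwards [hlt1] with ε hε1
    rw [smul_smul, mul_inv_cancel₀ (by linarith), one_smul]
  have hlim : Tendsto (fun ε => smoothToH1 hΩ hb (φ ε)) (𝓝[>] 0) (𝓝 u) := by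
    rw [tendsto_subtype_rng]
    exact ((WithLp.prod_continuous_toLp 2 (L2 Ω) (L2Vec Ω)).tendsto
      (H1.toL2 u, H1.grad u)).comp (htoL2.prodMk_nhds hgrad)
  exact mem_closure_of_tendsto hlim (Eventually.of_forall fun ε => mem_range_self _)

end RobinHelmholtz
end

/-! ### The trace operator and the bound for the Robin form -/

noncomputable section

namespace RobinHelmholtz

open Metric Set Filter Topology

variable {Ω : Set E3}

theorem continuous_toL2 : Continuous (H1.toL2 : H1 Ω → L2 Ω) :=
  (continuous_fst.comp (WithLp.prod_continuous_ofLp 2 (L2 Ω) (L2Vec Ω))).comp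
    continuous_subtype_val

theorem continuous_grad : Continuous (H1.grad : H1 Ω → L2Vec Ω) :=
  (continuous_snd.comp (WithLp.prod_continuous_ofLp 2 (L2 Ω) (L2Vec Ω))).comp
    continuous_subtype_val

theorem norm_sq_eq_norm_toL2_add_norm_grad (u : H1 Ω) :
    ‖u‖ ^ 2 = ‖H1.toL2 u‖ ^ 2 + ‖H1.grad u‖ ^ 2 :=
  WithLp.prod_norm_sq_eq_of_L2 (u : WithLp 2 (L2 Ω × L2Vec Ω))

/-- A trace operator restricts smooth functions to the boundary. -/
theorem IsTraceOperator.apply_smoothToH1 {γ : H1 Ω →L[ℂ] L2Boundary Ω} (hγ : IsTraceOperator Ω γ)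
    (hΩ : IsOpen Ω) (hb : Bornology.IsBounded Ω) (hfin : IsFiniteMeasure (surfaceMeasure Ω))
    (φ : smoothFunctions) : γ (smoothToH1 hΩ hb φ) = smoothTrace hb hfin φ :=
  Lp.ext ((hγ _ φ.1 φ.2 (coeFn_toL2_smoothToH1 hΩ hb φ)).trans (coeFn_smoothTrace hb hfin φ).symm)

/-- The trace theorem: existence and uniqueness of the trace operator. -/
theorem existsUnique_isTraceOperator (hΩ : IsOpen Ω) (hne : Ω.Nonempty)
    (hb : Bornology.IsBounded Ω) (hs : StarShapedWrtBall Ω) :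
    ∃! γ : H1 Ω →L[ℂ] L2Boundary Ω, IsTraceOperator Ω γ := by
  have hfin := isFiniteMeasure_surfaceMeasure hΩ hne hb hs
  have hdense := denseRange_smoothToH1 hΩ hb hs
  obtain ⟨C, hC⟩ := exists_norm_smoothTrace_sq_le hΩ hne hb hs hfin
  have hbound : ∀ φ, ‖smoothTrace hb hfin φ‖ ≤ Real.sqrt (2 * C) * ‖smoothToH1 hΩ hb φ‖ := by
    intro φ
    have h := norm_sq_eq_norm_toL2_add_norm_grad (smoothToH1 hΩ hb φ)
    refine (sq_le_sq₀ (norm_nonneg _) (by positivity)).1 ?_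
    rw [mul_pow, Real.sq_sqrt (by positivity), h]
    refine (hC φ).trans ?_
    rw [mul_comm (2 : ℝ), mul_assoc]
    gcongr
    nlinarith [sq_nonneg (‖H1.toL2 (smoothToH1 hΩ hb φ)‖ - ‖H1.grad (smoothToH1 hΩ hb φ)‖),
      sq_nonneg ‖H1.grad (smoothToH1 hΩ hb φ)‖, sq_nonneg ‖H1.toL2 (smoothToH1 hΩ hb φ)‖]
  refine ⟨(smoothTrace hb hfin).extendOfNorm (smoothToH1 hΩ hb), ?_, ?_⟩
  · intro u φ hφ hu
    -- Agreement of the functions almost everywhere suffices, because weak gradients are unique.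
    have h1 : u = smoothToH1 hΩ hb ⟨φ, hφ⟩ :=
      H1.ext_toL2 hΩ hb (Lp.ext (hu.trans (coeFn_toL2_smoothToH1 hΩ hb ⟨φ, hφ⟩).symm))
    rw [h1, LinearMap.extendOfNorm_eq hdense ⟨_, hbound⟩]
    exact coeFn_smoothTrace hb hfin ⟨φ, hφ⟩
  · intro γ hγ
    refine ContinuousLinearMap.ext fun u => congrFun
      (hdense.equalizer γ.continuous (ContinuousLinearMap.continuous _) (funext fun φ => ?_)) u
    simp only [Function.comp_apply]
    rw [hγ.apply_smoothToH1 hΩ hb hfin, LinearMap.extendOfNorm_eq hdense ⟨_, hbound⟩]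

/-- The multiplicative trace inequality. -/
theorem exists_norm_trace_sq_le (hΩ : IsOpen Ω) (hne : Ω.Nonempty)
    (hb : Bornology.IsBounded Ω) (hs : StarShapedWrtBall Ω) :
    ∃ C : NNReal, ∀ u : H1 Ω,
      ‖trace Ω u‖ ^ 2 ≤ C * (‖H1.toL2 u‖ ^ 2 + ‖H1.toL2 u‖ * ‖H1.grad u‖) := by
  have hfin := isFiniteMeasure_surfaceMeasure hΩ hne hb hs
  obtain ⟨C, hC⟩ := exists_norm_smoothTrace_sq_le hΩ hne hb hs hfin
  have hex := (existsUnique_isTraceOperator hΩ hne hb hs).exists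
  have htr : IsTraceOperator Ω (trace Ω) := by
    rw [trace, dif_pos hex]
    exact hex.choose_spec
  -- Both sides are continuous on `H¹(Ω)`, so the inequality passes from the dense smooth functions
  -- to all `u`.
  refine ⟨C, fun u => (denseRange_smoothToH1 hΩ hb hs).induction_on u ?_ fun φ => ?_⟩
  · refine isClosed_le ((trace Ω).continuous.norm.pow 2) (continuous_const.mul ?_)
    exact (continuous_toL2.norm.pow 2).add (continuous_toL2.norm.mul continuous_grad.norm)
  · rw [htr.apply_smoothToH1 hΩ hb hfin]
    exact hC φ

theorem robinForm_apply (ζ : ℂ) (u v : H1 Ω) :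
    robinForm Ω ζ u v = inner ℂ (H1.grad v) (H1.grad u) + ζ ^ 2 * inner ℂ (H1.toL2 v) (H1.toL2 u)
      + ζ * inner ℂ (trace Ω v) (trace Ω u) := rfl

theorem continuous_robinForm (ζ : ℂ) :
    Continuous fun p : H1 Ω × H1 Ω => robinForm Ω ζ p.1 p.2 := by
  simp only [robinForm_apply]
  have h1 := continuous_grad (Ω := Ω)
  have h2 := continuous_toL2 (Ω := Ω)
  have h3 := (trace Ω).continuous
  exact (((h1.comp continuous_snd).inner (h1.comp continuous_fst)).add
    (continuous_const.mul ((h2.comp continuous_snd).inner (h2.comp continuous_fst)))).add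
    (continuous_const.mul ((h3.comp continuous_snd).inner (h3.comp continuous_fst)))

/-- Cauchy–Schwarz for `(a, zb)` and `(a', zb')`; by Lagrange's identity the difference of the
squares is `(z (ab' - a'b))²`. -/
theorem mul_add_sq_mul_le_sqrt_mul_sqrt (a b a' b' z : ℝ) :
    a * a' + z ^ 2 * (b * b') ≤
      Real.sqrt (a ^ 2 + z ^ 2 * b ^ 2) * Real.sqrt (a' ^ 2 + z ^ 2 * b' ^ 2) := by
  rw [← Real.sqrt_mul (by positivity)]
  refine Real.le_sqrt_of_sq_le ?_
  nlinarith [sq_nonneg (z * (a * b' - a' * b))]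

/-- Multiplying the multiplicative trace inequality by the wave number. -/
theorem sqrt_mul_le_of_sq_le {C a b t z : ℝ} (hC : 0 ≤ C) (hz : 1 ≤ z)
    (h : t ^ 2 ≤ C * (b ^ 2 + b * a)) :
    Real.sqrt z * t ≤ Real.sqrt (2 * C) * Real.sqrt (a ^ 2 + z ^ 2 * b ^ 2) := by
  rw [← Real.sqrt_mul (by positivity)]
  refine Real.le_sqrt_of_sq_le ?_
  rw [mul_pow, Real.sq_sqrt (by linarith)]
  calc z * t ^ 2 ≤ z * (C * (b ^ 2 + b * a)) := by gcongr
    _ = C * (z * b ^ 2 + z * b * a) := by ring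
    -- `z b² ≤ z² b²` because `z ≥ 1`, and `(zb - a)² ≥ 0` absorbs the mixed term.
    _ ≤ C * (2 * (a ^ 2 + z ^ 2 * b ^ 2)) := by
        gcongr
        nlinarith [sq_nonneg (z * b - a), sq_nonneg a, mul_nonneg (sub_nonneg.2 hz) (sq_nonneg b),
          mul_nonneg (mul_nonneg (sub_nonneg.2 hz) (by linarith : 0 ≤ z)) (sq_nonneg b)]
    _ = _ := by ring

/-- Continuity of the Robin-Helmholtz form in the indexed norms. -/
theorem exists_norm_robinForm_le (hΩ : IsOpen Ω) (hne : Ω.Nonempty)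
    (hb : Bornology.IsBounded Ω) (hs : StarShapedWrtBall Ω) :
    ∃ C_b : ℝ, 0 ≤ C_b ∧ ∀ ζ : ℂ, 1 ≤ ‖ζ‖ → ∀ u v : H1 Ω,
      ‖robinForm Ω ζ u v‖ ≤ (1 + C_b) * indexedNorm ‖ζ‖ u * indexedNorm ‖ζ‖ v := by
  obtain ⟨C, hC⟩ := exists_norm_trace_sq_le hΩ hne hb hs
  -- Splitting `|ζ|` into two square roots, each trace contributes a factor `√(2C)`.
  refine ⟨2 * C, by positivity, fun ζ hζ u v => ?_⟩
  have hu := sqrt_mul_le_of_sq_le C.2 hζ (hC u)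
  have hv := sqrt_mul_le_of_sq_le C.2 hζ (hC v)
  have huv : ‖ζ‖ * (‖trace Ω v‖ * ‖trace Ω u‖) ≤
      2 * C * (indexedNorm ‖ζ‖ u * indexedNorm ‖ζ‖ v) := by
    have h := mul_le_mul hu hv (by positivity) (by positivity)
    have hz := Real.mul_self_sqrt (norm_nonneg ζ)
    have hc := Real.mul_self_sqrt (by positivity : (0 : ℝ) ≤ 2 * C)
    calc ‖ζ‖ * (‖trace Ω v‖ * ‖trace Ω u‖)
        = (Real.sqrt ‖ζ‖ * ‖trace Ω u‖) * (Real.sqrt ‖ζ‖ * ‖trace Ω v‖) := by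
          nth_rewrite 1 [← hz]; ring
      _ ≤ _ := h
      _ = (Real.sqrt (2 * C) * Real.sqrt (2 * C)) *
          (indexedNorm ‖ζ‖ u * indexedNorm ‖ζ‖ v) := by
          simp only [indexedNorm, NNReal.val_eq_coe]; ring
      _ = _ := by rw [hc]
  have hmain := mul_add_sq_mul_le_sqrt_mul_sqrt ‖H1.grad u‖ ‖H1.toL2 u‖ ‖H1.grad v‖ ‖H1.toL2 v‖ ‖ζ‖
  have htri : ‖robinForm Ω ζ u v‖ ≤ ‖H1.grad u‖ * ‖H1.grad v‖ +
      ‖ζ‖ ^ 2 * (‖H1.toL2 u‖ * ‖H1.toL2 v‖) + ‖ζ‖ * (‖trace Ω v‖ * ‖trace Ω u‖) := by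
    rw [robinForm_apply]
    refine (norm_add₃_le).trans ?_
    rw [norm_mul, norm_mul, norm_pow, mul_comm ‖H1.grad u‖, mul_comm ‖H1.toL2 u‖]
    gcongr <;> exact norm_inner_le_norm _ _
  calc ‖robinForm Ω ζ u v‖ ≤ _ := htri
    _ ≤ indexedNorm ‖ζ‖ u * indexedNorm ‖ζ‖ v +
        2 * C * (indexedNorm ‖ζ‖ u * indexedNorm ‖ζ‖ v) := add_le_add hmain huv
    _ = _ := by ring

end RobinHelmholtz
end

theorem mainTheorem1 (Ω : Set RobinHelmholtz.E3) (hΩ : RobinHelmholtz.IsAdmissibleDomain Ω) :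
    (∃! γ : RobinHelmholtz.H1 Ω →L[ℂ] RobinHelmholtz.L2Boundary Ω,
        RobinHelmholtz.IsTraceOperator Ω γ) ∧
      (∀ ζ : ℂ, 0 ≤ ζ.re →
        Continuous (fun p : RobinHelmholtz.H1 Ω × RobinHelmholtz.H1 Ω =>
          RobinHelmholtz.robinForm Ω ζ p.1 p.2)) ∧
      ∃ C_b : ℝ, 0 ≤ C_b ∧ ∀ ζ : ℂ, 0 ≤ ζ.re → 1 ≤ ‖ζ‖ →
        ∀ u v : RobinHelmholtz.H1 Ω,
          ‖RobinHelmholtz.robinForm Ω ζ u v‖ ≤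
            (1 + C_b) * RobinHelmholtz.indexedNorm ‖ζ‖ u * RobinHelmholtz.indexedNorm ‖ζ‖ v := by
  have hne := hΩ.isConnected.nonempty
  refine ⟨RobinHelmholtz.existsUnique_isTraceOperator hΩ.isOpen hne hΩ.isBounded hΩ.starShaped,
    fun ζ _ => RobinHelmholtz.continuous_robinForm ζ, ?_⟩
  obtain ⟨C, hC0, hC⟩ :=
    RobinHelmholtz.exists_norm_robinForm_le hΩ.isOpen hne hΩ.isBounded hΩ.starShaped
  exact ⟨C, hC0, fun ζ _ => hC ζ⟩
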